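/- For an open set $\Omega\subset\mathbb C^n$ and finitely many poles $P\subset\Omega$, let $$g_\Omega(z,P)=\sup f(z)\in[-\infty,0],$$ where $f$ runs over the plurisubharmonic functions $f:\Omega\to[-\infty,0)$ with a logarithmic pole of weight one at each $a\in P$, that is, $f(\zeta)-\log|\zeta-a|\le O(1)$ as $\zeta\to a$ (and $\sup\emptyset=-\infty$); write $g_\Omega(z,a)$ and $g_\Omega(z,a,b)$ for $P=\{a\}$ and $P=\{a,b\}$. A map $F:\Omega_1\to\Omega_2$ is called 2-to-1 if every fibre $F^{-1}(y)$, $y\in\Omega_2$, consists of one or two points and the points $y$ whose fibre has exactly two points are dense in $\Omega_2$. **Proposition.** Let $\Omega_1\subset\mathbb C^n$ and $\Omega_2\subset\mathbb C^m$ be domains (non-empty, open and connected) and let $F:\Omega_1\to\Omega_2$ be a proper holomorphic 2-to-1 map. Let $w_1\neq w_2$ be points of $\Omega_1$ with $F(w_1)=F(w_2)=w$. Then for every $z\in\Omega_1$ $$g_{\Omega_2}(F(z),w)=g_{\Omega_1}(z,w_1,w_2).$$ In particular, let $\mathbb D$ be the unit disk, $\pi(z_1,z_2)=(z_1+z_2,z_1z_2)$,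 and let $G=\pi(\mathbb D^2)$ be the symmetrized bidisk. Then for every $p\in\mathbb D\setminus\{0\}$ and every $(z_1,z_2)\in\mathbb D^2$ $$g_G\big((z_1+z_2,z_1z_2),(p,0)\big)=g_{\mathbb D^2}\big((z_1,z_2),(p,0),(0,p)\big).$$ -/

import Mathlib

open Set Filter Topology MeasureTheory

noncomputable section

/-- A domain: a non-empty connected open set. -/
def IsDomainSet {E : Type*} [TopologicalSpace E] (Ω : Set E) : Prop :=
  IsOpen Ω ∧ IsConnected Ω

/-- The mean value of `u` over the circle `{a + exp (iθ) b}`, as an extended real number: the mean of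
the positive part minus the mean of the negative part. For an upper semicontinuous `u < ∞` the
first of these is finite, so that the difference is the usual integral with values in
`[-∞, ∞)`. -/
def circleMean {E : Type*} [NormedAddCommGroup E] [NormedSpace ℂ E]
    (u : E → EReal) (a b : E) : EReal :=
  ((⨍⁻ θ, (u (a + circleMap 0 1 θ • b)).toENNReal
    ∂(volume.restrict (Ioc 0 (2 * Real.pi))) : ENNReal) : EReal) -
  ((⨍⁻ θ, (-u (a + circleMap 0 1 θ • b)).toENNReal
    ∂(volume.restrict (Ioc 0 (2 * Real.pi))) : ENNReal) : EReal)

/-- `u : Ω → [-∞, ∞)` is plurisubharmonic on the open set `Ω`: it is upper semicontinuous and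
satisfies the sub-mean value inequality on every closed complex disc `{a + t b : |t| ≤ 1}` in `Ω`.
The function that is identically `-∞` is allowed. Values outside `Ω` play no role. -/
structure IsPlurisubharmonicOn {E : Type*} [NormedAddCommGroup E] [NormedSpace ℂ E]
    (u : E → EReal) (Ω : Set E) : Prop where
  upperSemicontinuousOn : UpperSemicontinuousOn u Ω
  lt_top : ∀ z ∈ Ω, u z < ⊤
  le_circleMean : ∀ a b : E, (∀ t : ℂ, ‖t‖ ≤ 1 → a + t • b ∈ Ω) → u a ≤ circleMean u a b

/-- `f` has a logarithmic pole of weight `v` at `a`: `f z - v log |z - a| ≤ O(1)` as `z → a`. -/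
def HasLogPole {E : Type*} [NormedAddCommGroup E] (f : E → EReal) (v : ℝ) (a : E) : Prop :=
  ∃ C : ℝ, ∀ᶠ z in 𝓝[≠] a, f z ≤ ((v * Real.log ‖z - a‖ + C : ℝ) : EReal)

/-- The defining family of the pluricomplex Green function: the negative plurisubharmonic functions
on `Ω` with a logarithmic pole of weight `v p` at each `p ∈ P`. -/
def greenFamily {E : Type*} [NormedAddCommGroup E] [NormedSpace ℂ E]
    (Ω : Set E) (P : Set E) (v : E → ℝ) : Set (E → EReal) :=
  {f | IsPlurisubharmonicOn f Ω ∧ (∀ z ∈ Ω, f z < 0) ∧ ∀ p ∈ P, HasLogPole f (v p) p}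

/-- The pluricomplex Green function of `Ω` with poles `P` and weights `v`, with values in
`[-∞, 0]`. -/
def pluricomplexGreen {E : Type*} [NormedAddCommGroup E] [NormedSpace ℂ E]
    (Ω : Set E) (P : Set E) (v : E → ℝ) (z : E) : EReal :=
  ⨆ f ∈ greenFamily Ω P v, f z

/-- `F : Ω₁ → Ω₂` is two-to-one, branching being allowed: every fibre consists of one or two points,
and the points of `Ω₂` whose fibre has exactly two points are dense in `Ω₂`. -/
def IsTwoToOne {X Y : Type*} [TopologicalSpace Y] (F : X → Y) (Ω₁ : Set X) (Ω₂ : Set Y) : Prop :=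
  (∀ y ∈ Ω₂, (Ω₁ ∩ F ⁻¹' {y}).ncard = 1 ∨ (Ω₁ ∩ F ⁻¹' {y}).ncard = 2) ∧
  Ω₂ ⊆ closure {y ∈ Ω₂ | (Ω₁ ∩ F ⁻¹' {y}).ncard = 2}

/-- The bidisk in `ℂ²`. -/
def bidisk : Set (EuclideanSpace ℂ (Fin 2)) := {z | ‖z 0‖ < 1 ∧ ‖z 1‖ < 1}

/-- The symmetrization map `(z₁, z₂) ↦ (z₁ + z₂, z₁ z₂)`. -/
def symmetrization (z : EuclideanSpace ℂ (Fin 2)) : EuclideanSpace ℂ (Fin 2) :=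
  !₂[z 0 + z 1, z 0 * z 1]

/-- The symmetrized bidisk. -/
def symmetrizedBidisk : Set (EuclideanSpace ℂ (Fin 2)) := symmetrization '' bidisk

end

/-! Composition with `F` turns competitors on `Ω₂` into competitors on `Ω₁`: plurisubharmonicity
survives holomorphic substitution, and `F` is Lipschitz at `w₁` and `w₂`, so the pole of `f` at `w`
gives poles of `f ∘ F` at both points. This is one inequality. For the other, a competitor `f` on
`Ω₁` is pushed forward to the maximum of `f` over each fibre (`fiberSup`), which dominates `f` after
composition with `F`. It has to be plurisubharmonic with a logarithmic pole at `w`.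

Plurisubharmonicity rests on the maximum principle `le_re_of_local_sections`, applied upstairs to
the compact preimage of a disc. Adding a small multiple of `log |det F'|` keeps the maximum away
from the critical points, so only local holomorphic lifts at regular points are needed; critical
points are then reached by the sub-mean value inequality on a line along which the Jacobian has
isolated zeros. The same principle shows that plurisubharmonic functions are subharmonic along
analytic discs, that `F` is open at isolated points of its fibres, and a Schwarz lemma for local
inverses.

The pole at `w` requires `‖x - w₁‖ ≤ C ‖F x - w‖` near `w₁`, and likewise at `w₂`. Here the
two-point fibre enters: by openness at `w₂`, every value near `w` is taken near `w₂`, hence at most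
once near `w₁`. Thus `F` is injective over a neighbourhood of `w`, and the Schwarz lemma makes its
inverse Lipschitz (`exists_norm_sub_le_of_two_point_fiber`).

Finite fibres give an injective derivative on a dense set, and Hausdorff dimension gives the reverse
comparison, so `n = m` and the Jacobian makes sense. Throughout, circle means are replaced by the
equivalent test `HolomorphicSubmean` against real parts of holomorphic functions. -/

/-! ### Cauchy estimates and regularity of the derivative of a holomorphic map -/

section HolomorphicMaps

variable {E G : Type*} [NormedAddCommGroup E] [NormedSpace ℂ E] [NormedAddCommGroup G]
  [NormedSpace ℂ G]

/-- Cauchy's estimate for the derivative of a bounded holomorphic map on a ball. -/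
theorem norm_fderiv_le_of_norm_le_ball {F : E → G} {x : E} {R M : ℝ} (hR : 0 < R)
    (hF : DifferentiableOn ℂ F (Metric.ball x R)) (hM : ∀ z ∈ Metric.ball x R, ‖F z‖ ≤ M) :
    ‖fderiv ℂ F x‖ ≤ 2 * M / R := by
  have hM0 : 0 ≤ M := (norm_nonneg _).trans (hM x (Metric.mem_ball_self hR))
  refine ContinuousLinearMap.opNorm_le_bound _ (by positivity) fun v => ?_
  rcases eq_or_ne v 0 with rfl | hv
  · simp
  have hv0 : 0 < ‖v‖ := norm_pos_iff.2 hv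
  -- The factor 2 keeps the closed disc of radius `r` in direction `v` inside the open ball; it is
  -- the 2 in the final bound.
  set r : ℝ := R / (2 * ‖v‖) with hr
  have hr0 : 0 < r := by positivity
  have hmem : ∀ s ∈ Metric.closedBall (0 : ℂ) r, x + s • v ∈ Metric.ball x R := by
    intro s hs
    rw [mem_closedBall_zero_iff] at hs
    rw [mem_ball_iff_norm, add_sub_cancel_left, norm_smul]
    calc ‖s‖ * ‖v‖ ≤ r * ‖v‖ := by gcongr
      _ = R / 2 := by rw [hr]; field_simp
      _ < R := by linarith
  have hd : ∀ s ∈ Metric.closedBall (0 : ℂ) r,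
      HasDerivAt (fun s : ℂ => F (x + s • v)) (fderiv ℂ F (x + s • v) v) s := by
    intro s hs
    have h1 := (hF.differentiableAt (Metric.isOpen_ball.mem_nhds (hmem s hs))).hasFDerivAt
    have h2 : HasDerivAt (fun s : ℂ => x + s • v) v s := by
      simpa using ((hasDerivAt_id s).smul_const v).const_add x
    exact h1.comp_hasDerivAt s h2
  have h0 := hd 0 (by simp [hr0.le])
  simp only [zero_smul, add_zero] at h0
  have hcl : DiffContOnCl ℂ (fun s : ℂ => F (x + s • v)) (Metric.ball 0 r) :=
    DifferentiableOn.diffContOnCl_ball (U := Metric.closedBall 0 r)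
      (fun s hs => (hd s hs).differentiableAt.differentiableWithinAt) subset_rfl
  have := Complex.norm_deriv_le_of_forall_mem_sphere_norm_le hr0 hcl
    (fun s hs => hM _ (hmem s (Metric.sphere_subset_closedBall hs)))
  rw [h0.deriv] at this
  refine this.trans (le_of_eq ?_)
  rw [hr]; field_simp

/-- The derivative of a holomorphic map is locally Lipschitz. -/
theorem exists_norm_fderiv_sub_le {F : E → G} {U : Set E} (hU : IsOpen U)
    (hF : DifferentiableOn ℂ F U) {x₀ : E} (hx₀ : x₀ ∈ U) :
    ∃ C > 0, ∃ ρ > 0, Metric.ball x₀ ρ ⊆ U ∧ ∀ x ∈ Metric.ball x₀ ρ, ∀ y ∈ Metric.ball x₀ ρ,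
      ‖fderiv ℂ F y - fderiv ℂ F x‖ ≤ C * ‖y - x‖ := by
  have hcont : ContinuousAt F x₀ := (hF.differentiableAt (hU.mem_nhds hx₀)).continuousAt
  have hb : ∀ᶠ z in 𝓝 x₀, ‖F z‖ < ‖F x₀‖ + 1 := hcont.norm.eventually_lt_const (by linarith)
  obtain ⟨R, hR, hRU⟩ := Metric.mem_nhds_iff.1 (hb.and (hU.mem_nhds hx₀))
  set M := ‖F x₀‖ + 1 with hM
  have hM0 : 0 < M := by positivity
  -- Below, a point within `ρ` of `x` is shifted by `y - x`, which stays within `3ρ` of `x₀`; the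
  -- Cauchy estimate there needs one more `ρ`.
  set ρ := R / 4 with hρ
  have hρ0 : 0 < ρ := by positivity
  have hball : ∀ z, ‖z - x₀‖ < 4 * ρ → z ∈ U ∧ ‖F z‖ < M := by
    intro z hz
    have := hRU (show z ∈ Metric.ball x₀ R by rw [mem_ball_iff_norm]; linarith)
    exact ⟨this.2, this.1⟩
  have hA : ∀ z ∈ Metric.ball x₀ (3 * ρ), ‖fderiv ℂ F z‖ ≤ 2 * M / ρ := by
    intro z hz
    rw [mem_ball_iff_norm] at hz
    have : ∀ y ∈ Metric.ball z ρ, y ∈ U ∧ ‖F y‖ < M := by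
      intro y hy
      rw [mem_ball_iff_norm] at hy
      refine hball y ?_
      calc ‖y - x₀‖ = ‖(y - z) + (z - x₀)‖ := by congr 1; abel
        _ ≤ ‖y - z‖ + ‖z - x₀‖ := norm_add_le _ _
        _ < 4 * ρ := by linarith
    exact norm_fderiv_le_of_norm_le_ball hρ0 (hF.mono fun y hy => (this y hy).1)
      fun y hy => (this y hy).2.le
  have hdiff : ∀ z ∈ Metric.ball x₀ (3 * ρ), DifferentiableAt ℂ F z := by
    intro z hz
    rw [mem_ball_iff_norm] at hz
    exact hF.differentiableAt (hU.mem_nhds (hball z (by linarith)).1)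
  refine ⟨2 * (2 * M / ρ) / ρ, by positivity, ρ, hρ0, fun z hz => (hball z ?_).1, ?_⟩
  · rw [mem_ball_iff_norm] at hz; linarith
  intro x hx y hy
  rw [mem_ball_iff_norm] at hx hy
  have key : ∀ z ∈ Metric.ball x ρ, z ∈ Metric.ball x₀ (3 * ρ) ∧
      z + (y - x) ∈ Metric.ball x₀ (3 * ρ) := by
    intro z hz
    rw [mem_ball_iff_norm] at hz ⊢
    rw [mem_ball_iff_norm]
    constructor
    · calc ‖z - x₀‖ = ‖(z - x) + (x - x₀)‖ := by congr 1; abel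
        _ ≤ ‖z - x‖ + ‖x - x₀‖ := norm_add_le _ _
        _ < 3 * ρ := by linarith
    · calc ‖z + (y - x) - x₀‖ = ‖(z - x) + (y - x₀)‖ := by congr 1; abel
        _ ≤ ‖z - x‖ + ‖y - x₀‖ := norm_add_le _ _
        _ < 3 * ρ := by linarith
  -- The Cauchy estimate is applied to the increment of `F` by the fixed vector `y - x`, which is of
  -- size `O(‖y - x‖)` by the mean value inequality.
  have hd : ∀ z ∈ Metric.ball x ρ, HasFDerivAt (fun z => F (z + (y - x)) - F z)
      (fderiv ℂ F (z + (y - x)) - fderiv ℂ F z) z := by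
    intro z hz
    exact ((hasFDerivAt_comp_add_right _).2 (hdiff _ (key z hz).2).hasFDerivAt).sub
      (hdiff _ (key z hz).1).hasFDerivAt
  have hx' := hd x (Metric.mem_ball_self hρ0)
  rw [add_sub_cancel] at hx'
  rw [← hx'.fderiv]
  refine (norm_fderiv_le_of_norm_le_ball hρ0
    (fun z hz => (hd z hz).differentiableAt.differentiableWithinAt)
    (M := 2 * M / ρ * ‖y - x‖) fun z hz => ?_).trans (le_of_eq (by ring))
  have := (convex_ball x₀ (3 * ρ)).norm_image_sub_le_of_norm_fderiv_le hdiff hA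
    (key z hz).1 (key z hz).2
  simpa using this

theorem DifferentiableOn.continuousOn_fderiv_complex {F : E → G} {U : Set E} (hU : IsOpen U)
    (hF : DifferentiableOn ℂ F U) : ContinuousOn (fderiv ℂ F) U := by
  intro x₀ hx₀
  obtain ⟨C, -, ρ, hρ, -, h⟩ := exists_norm_fderiv_sub_le hU hF hx₀
  have : LipschitzOnWith C.toNNReal (fderiv ℂ F) (Metric.ball x₀ ρ) := by
    refine LipschitzOnWith.of_dist_le_mul fun x hx y hy => ?_
    rw [dist_eq_norm, dist_eq_norm]
    exact (h y hy x hx).trans (by gcongr; exact Real.le_coe_toNNReal C)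
  exact (this.continuousOn.continuousAt (Metric.ball_mem_nhds _ hρ)).continuousWithinAt

/-- This is the regularity that the inverse function theorem and the Hausdorff dimension estimate
ask for. -/
theorem DifferentiableOn.contDiffAt_one_complex {F : E → G} {U : Set E} (hU : IsOpen U)
    (hF : DifferentiableOn ℂ F U) {x : E} (hx : x ∈ U) : ContDiffAt ℂ 1 F x :=
  contDiffAt_one_iff.2 ⟨fderiv ℂ F, U, hU.mem_nhds hx, hF.continuousOn_fderiv_complex hU,
    fun _ hy => (hF.differentiableAt (hU.mem_nhds hy)).hasFDerivAt⟩

/-- Directional derivatives of a holomorphic map are holomorphic along holomorphic curves. -/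
theorem DifferentiableOn.fderiv_comp_curve [CompleteSpace G] {F : E → G} {U : Set E}
    (hU : IsOpen U) (hF : DifferentiableOn ℂ F U) {ψ : ℂ → E} {V : Set ℂ} (hV : IsOpen V)
    (hψ : DifferentiableOn ℂ ψ V) (hψU : MapsTo ψ V U) (v : E) :
    DifferentiableOn ℂ (fun t => fderiv ℂ F (ψ t) v) V := by
  intro t₀ ht₀
  obtain ⟨C, hC, ρ, hρ, hρU, h⟩ := exists_norm_fderiv_sub_le hU hF (hψU ht₀)
  have hN : ∀ᶠ t in 𝓝 t₀, t ∈ V ∧ ψ t ∈ Metric.ball (ψ t₀) (ρ / 2) :=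
    (hV.eventually_mem ht₀).and ((hψ.differentiableAt (hV.mem_nhds ht₀)).continuousAt
      (Metric.ball_mem_nhds _ (by positivity)))
  obtain ⟨N, hNs, hNo, ht₀N⟩ := mem_nhds_iff.1 hN
  have hsmall : ∀ᶠ s : ℂ in 𝓝[≠] 0, ‖s‖ * ‖v‖ < ρ / 2 := by
    have : Tendsto (fun s : ℂ => ‖s‖ * ‖v‖) (𝓝[≠] 0) (𝓝 0) := by
      have : Continuous (fun s : ℂ => ‖s‖ * ‖v‖) := by fun_prop
      simpa using (this.tendsto 0).mono_left nhdsWithin_le_nhds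
    exact this.eventually_lt_const (by positivity)
  have hmem : ∀ s : ℂ, ‖s‖ * ‖v‖ < ρ / 2 → ∀ t ∈ N, ψ t ∈ Metric.ball (ψ t₀) ρ ∧
      ψ t + s • v ∈ Metric.ball (ψ t₀) ρ := by
    intro s hs t ht
    have h1 := (hNs ht).2
    rw [mem_ball_iff_norm] at h1 ⊢
    rw [mem_ball_iff_norm]
    refine ⟨by linarith, ?_⟩
    calc ‖ψ t + s • v - ψ t₀‖ = ‖(ψ t - ψ t₀) + s • v‖ := by congr 1; abel
      _ ≤ ‖ψ t - ψ t₀‖ + ‖s • v‖ := norm_add_le _ _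
      _ < ρ := by rw [norm_smul]; linarith
  -- Difference quotients in direction `v` are holomorphic in `t` and converge locally uniformly,
  -- because the derivative is locally Lipschitz; Weierstrass' theorem in one variable then applies.
  have hlim : TendstoLocallyUniformlyOn
      (fun (s : ℂ) t => s⁻¹ • (F (ψ t + s • v) - F (ψ t))) (fun t => fderiv ℂ F (ψ t) v)
      (𝓝[≠] 0) N := by
    refine TendstoUniformlyOn.tendstoLocallyUniformlyOn ?_
    rw [Metric.tendstoUniformlyOn_iff]
    intro ε hε
    have hsm2 : ∀ᶠ s : ℂ in 𝓝[≠] 0, C * ‖s‖ * ‖v‖ * ‖v‖ < ε := by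
      have : Tendsto (fun s : ℂ => C * ‖s‖ * ‖v‖ * ‖v‖) (𝓝[≠] 0) (𝓝 0) := by
        have : Continuous (fun s : ℂ => C * ‖s‖ * ‖v‖ * ‖v‖) := by fun_prop
        simpa using (this.tendsto 0).mono_left nhdsWithin_le_nhds
      exact this.eventually_lt_const hε
    filter_upwards [hsmall, hsm2, self_mem_nhdsWithin] with s hs1 hs2 hs0 t ht
    have hs0 : s ≠ 0 := hs0
    obtain ⟨hm1, hm2⟩ := hmem s hs1 t ht
    have hseg : segment ℝ (ψ t) (ψ t + s • v) ⊆ Metric.ball (ψ t₀) ρ :=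
      (convex_ball _ _).segment_subset hm1 hm2
    have := (convex_segment (𝕜 := ℝ) (ψ t) (ψ t + s • v)).norm_image_sub_le_of_norm_fderiv_le'
      (𝕜 := ℂ) (f := F) (φ := fderiv ℂ F (ψ t)) (C := C * ‖s • v‖)
      (fun z hz => hF.differentiableAt (hU.mem_nhds (hρU (hseg hz))))
      (fun z hz => (h _ hm1 _ (hseg hz)).trans (by
        gcongr
        obtain ⟨a, b, ha, hb, hab, rfl⟩ := hz
        have : a • ψ t + b • (ψ t + s • v) - ψ t = b • (s • v) := by
          rw [smul_add, ← add_assoc, ← add_smul, hab, one_smul]; abel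
        rw [this, norm_smul, Real.norm_of_nonneg hb]
        nlinarith [norm_nonneg (s • v)]))
      (left_mem_segment _ _ _) (right_mem_segment _ _ _)
    rw [add_sub_cancel_left, map_smul] at this
    rw [dist_comm, dist_eq_norm]
    have e : s⁻¹ • (F (ψ t + s • v) - F (ψ t)) - fderiv ℂ F (ψ t) v =
        s⁻¹ • (F (ψ t + s • v) - F (ψ t) - s • fderiv ℂ F (ψ t) v) := by
      rw [smul_sub s⁻¹ (_ - _), smul_smul, inv_mul_cancel₀ hs0, one_smul]
    rw [e, norm_smul, norm_inv]
    refine lt_of_le_of_lt ?_ hs2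
    have hs0' : 0 < ‖s‖ := norm_pos_iff.2 hs0
    rw [inv_mul_le_iff₀ hs0']
    refine this.trans (le_of_eq ?_)
    rw [norm_smul]; ring
  have := hlim.differentiableOn (by
    filter_upwards [hsmall] with s hs t ht
    obtain ⟨hm1, hm2⟩ := hmem s hs t ht
    have hψt := hψ.differentiableAt (hV.mem_nhds (hNs ht).1)
    have h1 := (hF.differentiableAt (hU.mem_nhds (hρU hm1))).comp t hψt
    have h2 := (hF.differentiableAt (hU.mem_nhds (hρU hm2))).comp t (hψt.add_const (s • v))
    exact ((h2.sub h1).const_smul s⁻¹).differentiableWithinAt) hNo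
  exact (this.differentiableAt (hNo.mem_nhds ht₀N)).differentiableWithinAt

end HolomorphicMaps

section Jacobian

variable {E : Type*} [NormedAddCommGroup E] [NormedSpace ℂ E] [FiniteDimensional ℂ E]

/-- The Leibniz formula writes the Jacobian as a polynomial in coordinates of directional
derivatives. Holomorphy along curves is enough for the identity theorem on lines and for logarithms
along lifts. -/
theorem DifferentiableOn.det_fderiv_comp_curve {F : E → E} {U : Set E} (hU : IsOpen U)
    (hF : DifferentiableOn ℂ F U) {ψ : ℂ → E} {V : Set ℂ} (hV : IsOpen V)
    (hψ : DifferentiableOn ℂ ψ V) (hψU : MapsTo ψ V U) :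
    DifferentiableOn ℂ (fun t => (fderiv ℂ F (ψ t)).det) V := by
  have : CompleteSpace E := FiniteDimensional.complete ℂ E
  let b := Module.finBasis ℂ E
  have hdet : ∀ t, (fderiv ℂ F (ψ t)).det =
      ∑ σ : Equiv.Perm (Fin (Module.finrank ℂ E)),
        ((Equiv.Perm.sign σ : ℤ) : ℂ) * ∏ i, b.coord (σ i) (fderiv ℂ F (ψ t) (b i)) := by
    intro t
    rw [ContinuousLinearMap.det, ← LinearMap.det_toMatrix b, Matrix.det_apply']
    simp [LinearMap.toMatrix_apply]
  simp_rw [hdet]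
  refine DifferentiableOn.fun_sum fun σ _ => (differentiableOn_const _).mul ?_
  refine DifferentiableOn.fun_finsetProd fun i _ => ?_
  have hlin := (LinearMap.toContinuousLinearMap (b.coord (σ i))).differentiable
  exact hlin.comp_differentiableOn (hF.fderiv_comp_curve hU hV hψ hψU (b i))

end Jacobian

theorem DifferentiableOn.continuousOn_det_fderiv {E : Type*} [NormedAddCommGroup E]
    [NormedSpace ℂ E] {F : E → E} {U : Set E} (hU : IsOpen U)
    (hF : DifferentiableOn ℂ F U) : ContinuousOn (fun x => (fderiv ℂ F x).det) U :=
  ContinuousLinearMap.continuous_det.comp_continuousOn (hF.continuousOn_fderiv_complex hU)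

/-! ### The sub-mean value inequality tested against real parts of holomorphic functions -/

/-- `u` satisfies the sub-mean value inequality at the centre of the disc against real parts of
holomorphic functions: every such majorant on the boundary circle is a majorant at the centre. -/
def HolomorphicSubmean (u : ℂ → EReal) (c : ℂ) (r : ℝ) : Prop :=
  ∀ H : ℂ → ℂ, DiffContOnCl ℂ H (Metric.ball c r) →
    (∀ t ∈ Metric.sphere c r, u t ≤ ((H t).re : EReal)) → u c ≤ ((H c).re : EReal)

/-- An extended real number as the difference of positive and negative parts. -/
theorem coe_average_eq_sub {α : Type*} [MeasurableSpace α] {μ : Measure α} [IsFiniteMeasure μ]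
    {g : α → ℝ} (hg : Integrable g μ) :
    ((⨍ x, g x ∂μ : ℝ) : EReal) =
      ((⨍⁻ x, ENNReal.ofReal (g x) ∂μ : ENNReal) : EReal) -
        ((⨍⁻ x, ENNReal.ofReal (-g x) ∂μ : ENNReal) : EReal) := by
  have hν : Integrable g ((μ univ)⁻¹ • μ) := hg.to_average
  have h1 : ∫⁻ x, ENNReal.ofReal (g x) ∂((μ univ)⁻¹ • μ) ≠ ⊤ :=
    (hν.lintegral_lt_top).ne
  have h2 : ∫⁻ x, ENNReal.ofReal (-g x) ∂((μ univ)⁻¹ • μ) ≠ ⊤ :=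
    (hν.neg.lintegral_lt_top).ne
  rw [average, laverage, laverage, integral_eq_lintegral_pos_part_sub_lintegral_neg_part hν,
    EReal.coe_sub, EReal.coe_ennreal_toReal h1, EReal.coe_ennreal_toReal h2]

/-- Positive and negative parts are compared separately as lower integrals, so no measurability of
`u` is needed. -/
theorem circleMean_le_average {E : Type*} [NormedAddCommGroup E] [NormedSpace ℂ E]
    {u : E → EReal} {a b : E} {g : ℝ → ℝ}
    (hg : Integrable g (volume.restrict (Ioc 0 (2 * Real.pi))))
    (h : ∀ θ, u (a + circleMap 0 1 θ • b) ≤ (g θ : EReal)) :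
    circleMean u a b ≤ ((⨍ θ, g θ ∂(volume.restrict (Ioc 0 (2 * Real.pi))) : ℝ) : EReal) := by
  rw [coe_average_eq_sub hg, circleMean]
  refine EReal.sub_le_sub ?_ ?_
  · refine EReal.coe_ennreal_le_coe_ennreal_iff.2 (lintegral_mono fun θ => ?_)
    exact (EReal.toENNReal_le_toENNReal (h θ)).trans (by simp [EReal.toENNReal])
  · refine EReal.coe_ennreal_le_coe_ennreal_iff.2 (lintegral_mono fun θ => ?_)
    refine le_trans ?_ (EReal.toENNReal_le_toENNReal (EReal.neg_le_neg_iff.2 (h θ)))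
    rw [← EReal.coe_neg]
    simp [EReal.toENNReal]

theorem circleAverage_re_eq {H : ℂ → ℂ} {c : ℂ} {r : ℝ} (hr : 0 < r)
    (hH : DiffContOnCl ℂ H (Metric.ball c r)) :
    Real.circleAverage (fun t => (H t).re) c r = (H c).re := by
  have hH' : DiffContOnCl ℂ H (Metric.ball c |r|) := by rwa [abs_of_pos hr]
  have hc : CircleIntegrable H c r := by
    refine ContinuousOn.circleIntegrable hr.le (hH.continuousOn.mono ?_)
    rw [closure_ball _ hr.ne']
    exact Metric.sphere_subset_closedBall
  have := Complex.reCLM.circleAverage_comp_comm hc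
  rw [hH'.circleAverage] at this
  exact this

/-- The circle mean of `u` is at most that of `Re H`, which equals the value of `Re H` at the centre
by the mean value property. -/
theorem IsPlurisubharmonicOn.holomorphicSubmean {E : Type*} [NormedAddCommGroup E]
    [NormedSpace ℂ E] {u : E → EReal} {Ω : Set E} (hu : IsPlurisubharmonicOn u Ω) {a b : E}
    {c : ℂ} {r : ℝ} (hr : 0 < r) (h : ∀ t ∈ Metric.closedBall c r, a + t • b ∈ Ω) :
    HolomorphicSubmean (fun t => u (a + t • b)) c r := by
  intro H hH hle
  have hmap : ∀ t : ℂ, a + c • b + t • (r : ℂ) • b = a + (c + t * r) • b := by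
    intro t; rw [smul_smul, add_smul, add_assoc]
  have hcirc : ∀ θ, c + circleMap 0 1 θ * r = circleMap c r θ := by
    intro θ; simp [circleMap]; ring
  have h1 := hu.le_circleMean (a + c • b) ((r : ℂ) • b) (fun t ht => by
    rw [hmap]
    refine h _ ?_
    rw [mem_closedBall_iff_norm, add_sub_cancel_left, norm_mul, Complex.norm_real,
      Real.norm_of_nonneg hr.le]
    nlinarith)
  have hcont : Continuous fun θ => (H (circleMap c r θ)).re := by
    refine Complex.continuous_re.comp (hH.continuousOn.comp_continuous (continuous_circleMap c r)
      fun θ => ?_)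
    rw [closure_ball _ hr.ne']
    exact circleMap_mem_closedBall c hr.le θ
  have h2 := circleMean_le_average (u := u) (a := a + c • b) (b := (r : ℂ) • b)
    (g := fun θ => (H (circleMap c r θ)).re)
    ((hcont.integrableOn_Icc (a := 0) (b := 2 * Real.pi)).mono_set Ioc_subset_Icc_self) (fun θ => by
      rw [hmap, hcirc]
      exact hle _ (circleMap_mem_sphere c hr.le θ))
  refine h1.trans (h2.trans (le_of_eq ?_))
  rw [← circleAverage_re_eq hr hH, Real.circleAverage_eq_intervalAverage,
    uIoc_of_le (by positivity)]

theorem holomorphicSubmean_re {H : ℂ → ℂ} {c : ℂ} {r : ℝ} (hr : 0 < r)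
    (hH : DiffContOnCl ℂ H (Metric.ball c r)) :
    HolomorphicSubmean (fun t => ((H t).re : EReal)) c r := by
  intro G hG hle
  change ((H c).re : EReal) ≤ _
  rw [← circleAverage_re_eq hr hH, ← circleAverage_re_eq hr hG, EReal.coe_le_coe_iff]
  have key : ∀ {K : ℂ → ℂ}, DiffContOnCl ℂ K (Metric.ball c r) →
      CircleIntegrable (fun t => (K t).re) c r := by
    intro K hK
    refine ContinuousOn.circleIntegrable hr.le
      (Complex.continuous_re.comp_continuousOn (hK.continuousOn.mono ?_))
    rw [closure_ball _ hr.ne']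
    exact Metric.sphere_subset_closedBall
  refine Real.circleAverage_mono (key hH) (key hG) fun t ht => ?_
  rw [abs_of_pos hr] at ht
  exact EReal.coe_le_coe_iff.1 (hle t ht)

/-! ### The maximum principle on a compact set fibred over the disc -/

/-- A maximum principle off the zero set of `D`: `f` is a function on a compact set fibred over the
closed unit disc by `T`, and near every point where `D ≠ 0` and `f` exceeds the harmonic majorant
there is a section along which `f` is subharmonic up to `o(r ^ 2)` and `D` has a logarithm. -/
theorem le_re_of_local_sections {α : Type*} [TopologicalSpace α] {K : Set α} (hK : IsCompact K)
    {T : α → ℂ} (hT : ContinuousOn T K) (hT1 : ∀ x ∈ K, ‖T x‖ ≤ 1) {f : α → EReal}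
    (hf : UpperSemicontinuousOn f K) (hf_top : ∀ x ∈ K, f x < ⊤) {D : α → ℂ}
    (hD : ContinuousOn D K) {H : ℂ → ℂ} (hH : DiffContOnCl ℂ H (Metric.ball 0 1))
    (hbdry : ∀ x ∈ K, ‖T x‖ = 1 → f x ≤ ((H (T x)).re : EReal))
    (hloc : ∀ x ∈ K, ‖T x‖ < 1 → D x ≠ 0 → ((H (T x)).re : EReal) < f x → ∀ ε > 0,
      ∃ r > 0, ∃ ψ : ℂ → α, ∃ L : ℂ → ℂ, ψ (T x) = x ∧
        (∀ t ∈ Metric.closedBall (T x) r, ψ t ∈ K ∧ T (ψ t) = t ∧ D (ψ t) = Complex.exp (L t)) ∧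
        DiffContOnCl ℂ L (Metric.ball (T x) r) ∧
        ∀ G : ℂ → ℂ, DiffContOnCl ℂ G (Metric.ball (T x) r) →
          (∀ t ∈ Metric.sphere (T x) r, f (ψ t) ≤ ((G t).re : EReal)) →
          f x ≤ (((G (T x)).re + ε * r ^ 2 : ℝ) : EReal)) :
    ∀ x ∈ K, D x ≠ 0 → f x ≤ ((H (T x)).re : EReal) := by
  intro x₁ hx₁ hDx₁
  by_contra! hlt
  obtain ⟨a₁, ha₁⟩ : ∃ a : ℝ, f x₁ = a :=
    ⟨(f x₁).toReal, (EReal.coe_toReal (hf_top x₁ hx₁).ne hlt.ne_bot).symm⟩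
  rw [ha₁, EReal.coe_lt_coe_iff] at hlt
  obtain ⟨B, hB⟩ := hK.exists_bound_of_continuousOn hD
  set B' := max B 1
  have hB1 : 1 ≤ B' := le_max_right _ _
  have hBD : ∀ x ∈ K, ‖D x‖ ≤ B' := fun x hx => (hB x hx).trans (le_max_left _ _)
  set η := a₁ - (H (T x₁)).re with hη
  have hη0 : 0 < η := sub_pos.2 hlt
  -- `ε * q` bounds what the perturbation `ε |T|² + ε log |D|` can gain between `x₁` and another
  -- point. With `ε * q = η / 2`, half of the excess `η` survives at the maximum point.
  set q := 1 + Real.log B' - Real.log ‖D x₁‖ with hq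
  have hq1 : 1 ≤ q := by
    have := Real.log_le_log (norm_pos_iff.2 hDx₁) (hBD x₁ hx₁)
    linarith
  set ε := η / (2 * q) with hε
  have hε0 : 0 < ε := by positivity
  have hεq : ε * q = η / 2 := by rw [hε]; field_simp
  let w : α → ℝ := fun x => -(H (T x)).re + ε * ‖T x‖ ^ 2
  -- This is `ε log |D|`, written so that it is continuous with value `-∞` on the zeros of `D`;
  -- `Real.log` would give `0` there.
  let l : α → EReal := fun x => ENNReal.log (ENNReal.ofReal (‖D x‖ ^ ε))
  have hHT : ContinuousOn (fun x => H (T x)) K := by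
    refine hH.continuousOn.comp hT fun x hx => ?_
    rw [closure_ball _ one_ne_zero]
    simpa using hT1 x hx
  have hw : ContinuousOn w K :=
    (Complex.continuous_re.comp_continuousOn hHT).neg.add
      (continuousOn_const.mul (hT.norm.pow 2))
  have hl : ContinuousOn l K := by
    refine ENNReal.continuous_log.comp_continuousOn
      (ENNReal.continuous_ofReal.comp_continuousOn ?_)
    exact hD.norm.rpow_const fun x _ => Or.inr hε0.le
  have hltop : ∀ x, l x ≠ ⊤ := by
    intro x
    simp only [l]
    rw [Ne, ENNReal.log_eq_top_iff]
    exact ENNReal.ofReal_ne_top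
  have hlD : ∀ x, D x ≠ 0 → l x = ((ε * Real.log ‖D x‖ : ℝ) : EReal) := by
    intro x hx
    have h0 : 0 < ‖D x‖ := norm_pos_iff.2 hx
    simp only [l]
    rw [ENNReal.log_ofReal_of_pos (Real.rpow_pos_of_pos h0 _), Real.log_rpow h0]
  have hlD0 : ∀ x, D x = 0 → l x = ⊥ := by
    intro x hx
    simp [l, hx, Real.zero_rpow hε0.ne']
  let Φ : α → EReal := fun x => f x + (w x : EReal) + l x
  have hΦ : UpperSemicontinuousOn Φ K := by
    refine UpperSemicontinuousOn.add' (UpperSemicontinuousOn.add' hf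
      (continuous_coe_real_ereal.comp_continuousOn hw).upperSemicontinuousOn ?_)
      hl.upperSemicontinuousOn ?_
    · intro x hx
      exact EReal.continuousAt_add (Or.inr (EReal.coe_ne_bot _)) (Or.inr (EReal.coe_ne_top _))
    · intro x hx
      refine EReal.continuousAt_add (Or.inl ?_) (Or.inr (hltop x))
      exact (EReal.add_lt_top (hf_top x hx).ne (EReal.coe_ne_top _)).ne
  have hΦreal : ∀ x (a : ℝ), D x ≠ 0 → f x = a →
      Φ x = ((a + w x + ε * Real.log ‖D x‖ : ℝ) : EReal) := by
    intro x a hDx hfx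
    simp only [Φ, hlD x hDx, hfx, EReal.coe_add]
  -- Since `Φ x₁` is finite, the maximum point has `D y ≠ 0`; the surviving excess and the boundary
  -- hypothesis put it over the open disc. A section through `y` is therefore available.
  obtain ⟨y, hy, hmax⟩ := hΦ.exists_isMaxOn ⟨x₁, hx₁⟩ hK
  have hy1 : Φ x₁ ≤ Φ y := hmax hx₁
  rw [hΦreal x₁ a₁ hDx₁ ha₁] at hy1
  have hDy : D y ≠ 0 := by
    intro h
    simp only [Φ, hlD0 y h, EReal.add_bot, le_bot_iff] at hy1
    exact EReal.coe_ne_bot _ hy1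
  have hfy : f y ≠ ⊥ := by
    intro h
    simp only [Φ, h, EReal.bot_add, le_bot_iff] at hy1
    exact EReal.coe_ne_bot _ hy1
  obtain ⟨a, ha⟩ : ∃ a : ℝ, f y = a :=
    ⟨(f y).toReal, (EReal.coe_toReal (hf_top y hy).ne hfy).symm⟩
  rw [hΦreal y a hDy ha, EReal.coe_le_coe_iff] at hy1
  have hlogy : Real.log ‖D y‖ ≤ Real.log B' :=
    Real.log_le_log (norm_pos_iff.2 hDy) (hBD y hy)
  have hTy := hT1 y hy
  have hay : (H (T y)).re < a := by
    simp only [w] at hy1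
    have h1 : ε * ‖T y‖ ^ 2 ≤ ε := by
      have : ‖T y‖ ^ 2 ≤ 1 := pow_le_one₀ (norm_nonneg _) hTy
      nlinarith
    have h2 : 0 ≤ ε * ‖T x₁‖ ^ 2 := by positivity
    have h3 : ε * Real.log ‖D y‖ ≤ ε * Real.log B' := by gcongr
    have h4 : ε * (1 + Real.log B' - Real.log ‖D x₁‖) = η / 2 := hεq
    linarith
  have hTy1 : ‖T y‖ < 1 := by
    refine lt_of_le_of_ne hTy fun h => ?_
    have := hbdry y hy h
    rw [ha, EReal.coe_le_coe_iff] at this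
    linarith
  obtain ⟨r, hr, ψ, L, hψy, hψ, hL, hG⟩ := hloc y hy hTy1 hDy
    (by rw [ha]; exact EReal.coe_lt_coe_iff.2 hay) (ε / 2) (by positivity)
  have hsub : Metric.ball (T y) r ⊆ Metric.ball 0 1 := by
    have h1 : Metric.closedBall (T y) r ⊆ Metric.closedBall 0 1 := by
      intro t ht
      have := hψ t ht
      rw [mem_closedBall_zero_iff, ← this.2.1]
      exact hT1 _ this.1
    have := interior_mono (Metric.ball_subset_closedBall.trans h1)
    rwa [interior_closedBall _ one_ne_zero, Metric.isOpen_ball.interior_eq] at this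
  have hLy := (hψ (T y) (Metric.mem_closedBall_self hr.le)).2.2
  rw [hψy] at hLy
  -- On the circle of radius `r` about `T y`, `|t|²` is the real part of an affine function plus a
  -- constant containing `r²`. So maximality of `Φ` at `y` bounds `f ∘ ψ` there by the real part of
  -- the holomorphic `G`, whose value at the centre is `a - ε r²`. The local hypothesis, used with
  -- error `ε / 2`, is then contradicted.
  set κ : ℝ := a - (H (T y)).re + ε * (L (T y)).re - ε * r ^ 2 with hκ
  let G : ℂ → ℂ := fun t =>
    H t - (ε : ℂ) * (2 * (starRingEnd ℂ (T y)) * (t - T y)) - (ε : ℂ) * L t + (κ : ℂ)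
  have hGre : ∀ t, (G t).re = (H t).re - ε * (2 * (starRingEnd ℂ (T y) * (t - T y)).re)
      - ε * (L t).re + κ := by
    intro t
    simp only [G, Complex.add_re, Complex.sub_re, Complex.re_ofReal_mul, Complex.ofReal_re]
    rw [mul_assoc 2, show (2 : ℂ) = ((2 : ℝ) : ℂ) by norm_num, Complex.re_ofReal_mul]
  have hlogexp : ∀ z : ℂ, Real.log ‖Complex.exp z‖ = z.re := by
    intro z; rw [Complex.norm_exp, Real.log_exp]
  have hGd : DiffContOnCl ℂ G (Metric.ball (T y) r) := by
    have h1 : DiffContOnCl ℂ (fun t : ℂ => (ε : ℂ) * (2 * (starRingEnd ℂ (T y)) * (t - T y)))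
        (Metric.ball (T y) r) :=
      Differentiable.diffContOnCl (by fun_prop)
    exact (((hH.mono hsub).sub h1).sub (hL.const_smul (ε : ℂ))).add_const (κ : ℂ)
  have := hG G hGd (fun t ht => by
    obtain ⟨h1, h2, h3⟩ := hψ t (Metric.sphere_subset_closedBall ht)
    by_cases hbot : f (ψ t) = ⊥
    · rw [hbot]; exact bot_le
    obtain ⟨a', ha'⟩ : ∃ a : ℝ, f (ψ t) = a :=
      ⟨(f (ψ t)).toReal, (EReal.coe_toReal (hf_top _ h1).ne hbot).symm⟩
    have hle : Φ (ψ t) ≤ Φ y := hmax h1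
    have hDt : D (ψ t) ≠ 0 := by rw [h3]; exact Complex.exp_ne_zero _
    rw [hΦreal _ a' hDt ha', hΦreal y a hDy ha, EReal.coe_le_coe_iff] at hle
    simp only [w, h2] at hle
    rw [h3, hLy, hlogexp, hlogexp] at hle
    rw [ha', EReal.coe_le_coe_iff, hGre]
    have hnorm : ‖t‖ ^ 2 = ‖T y‖ ^ 2 + 2 * (starRingEnd ℂ (T y) * (t - T y)).re + r ^ 2 := by
      rw [mem_sphere_iff_norm] at ht
      rw [← ht, ← Complex.normSq_eq_norm_sq, ← Complex.normSq_eq_norm_sq,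
        ← Complex.normSq_eq_norm_sq]
      simp only [Complex.normSq_apply, Complex.mul_re, Complex.conj_re, Complex.conj_im,
        Complex.sub_re, Complex.sub_im]
      ring
    rw [hnorm] at hle
    rw [hκ]
    linarith)
  rw [ha, EReal.coe_le_coe_iff, hGre, sub_self, mul_zero, Complex.zero_re, hκ] at this
  have hr2 : 0 < ε * r ^ 2 := by positivity
  linarith

/-! ### Plurisubharmonic functions along analytic discs -/

theorem EReal.add_coe_le_coe_iff {x : EReal} {r s : ℝ} :
    x + (r : EReal) ≤ (s : EReal) ↔ x ≤ ((s - r : ℝ) : EReal) := by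
  induction x with
  | bot => simp
  | top => simp only [EReal.top_add_coe, top_le_iff, EReal.coe_ne_top]
  | coe x =>
    rw [← EReal.coe_add, EReal.coe_le_coe_iff, EReal.coe_le_coe_iff]
    constructor <;> intro h <;> linarith

theorem UpperSemicontinuousOn.add_coe {α : Type*} [TopologicalSpace α] {s : Set α}
    {f : α → EReal} (hf : UpperSemicontinuousOn f s) {g : α → ℝ} (hg : ContinuousOn g s) :
    UpperSemicontinuousOn (fun x => f x + (g x : EReal)) s :=
  hf.add' (continuous_coe_real_ereal.comp_continuousOn hg).upperSemicontinuousOn fun _ _ =>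
    EReal.continuousAt_add (Or.inr (EReal.coe_ne_bot _)) (Or.inr (EReal.coe_ne_top _))

theorem UpperSemicontinuousOn.exists_coe_bound {α : Type*} [TopologicalSpace α] {s : Set α}
    (hs : IsCompact s) {f : α → EReal} (hf : UpperSemicontinuousOn f s)
    (hf_top : ∀ x ∈ s, f x < ⊤) : ∃ A : ℝ, ∀ x ∈ s, f x ≤ A := by
  rcases s.eq_empty_or_nonempty with rfl | hne
  · exact ⟨0, by simp⟩
  obtain ⟨y, hy, hmax⟩ := hf.exists_isMaxOn hne hs
  exact ⟨(f y).toReal, fun x hx =>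
    le_trans (hmax hx) (EReal.le_coe_toReal (hf_top y hy).ne)⟩

/-- Quadratic bound for the first-order Taylor remainder of a holomorphic curve. -/
theorem exists_norm_taylor_remainder_le {E : Type*} [NormedAddCommGroup E] [NormedSpace ℂ E]
    [CompleteSpace E] {φ : ℂ → E} {V : Set ℂ} {t₀ : ℂ} (hV : V ∈ 𝓝 t₀)
    (hφ : DifferentiableOn ℂ φ V) :
    ∃ C > 0, ∀ᶠ t in 𝓝 t₀, ‖φ t - φ t₀ - (t - t₀) • deriv φ t₀‖ ≤ C * ‖t - t₀‖ ^ 2 := by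
  have h1 : DifferentiableOn ℂ (dslope (dslope φ t₀) t₀) V :=
    (Complex.differentiableOn_dslope hV).2 ((Complex.differentiableOn_dslope hV).2 hφ)
  have h2 : ContinuousAt (dslope (dslope φ t₀) t₀) t₀ := (h1.differentiableAt hV).continuousAt
  refine ⟨‖dslope (dslope φ t₀) t₀ t₀‖ + 1, by positivity, ?_⟩
  filter_upwards [h2.norm.eventually_lt_const (lt_add_one _)] with t ht
  have h3 : φ t - φ t₀ - (t - t₀) • deriv φ t₀ =
      ((t - t₀) * (t - t₀)) • dslope (dslope φ t₀) t₀ t := by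
    rw [mul_smul, sub_smul_dslope (dslope φ t₀), smul_sub, sub_smul_dslope φ, dslope_same]
  rw [h3, norm_smul, norm_mul, ← sq, mul_comm]
  gcongr

/-- Plurisubharmonic functions satisfy the sub-mean value inequality on analytic discs. -/
theorem IsPlurisubharmonicOn.holomorphicSubmean_comp {E : Type*} [NormedAddCommGroup E]
    [InnerProductSpace ℂ E] [FiniteDimensional ℂ E] {u : E → EReal} {Ω : Set E}
    (hΩ : IsOpen Ω) (hu : IsPlurisubharmonicOn u Ω) {φ : ℂ → E} {V : Set ℂ} (hV : IsOpen V)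
    (hφ : DifferentiableOn ℂ φ V) (hVsub : Metric.closedBall 0 1 ⊆ V)
    (hmaps : ∀ t ∈ Metric.closedBall (0 : ℂ) 1, φ t ∈ Ω) :
    HolomorphicSubmean (fun t => u (φ t)) 0 1 := by
  have : ProperSpace E := FiniteDimensional.proper ℂ E
  have : CompleteSpace E := FiniteDimensional.complete ℂ E
  intro H hH hle
  have hφc : ContinuousOn φ (Metric.closedBall 0 1) := hφ.continuousOn.mono hVsub
  have hBc : IsCompact (Metric.closedBall (0 : ℂ) 1) := isCompact_closedBall 0 1
  obtain ⟨δ, hδ, hδΩ⟩ := (hBc.image_of_continuousOn hφc).exists_cthickening_subset_open hΩ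
    (by rintro _ ⟨t, ht, rfl⟩; exact hmaps t ht)
  have hthick : ∀ t ∈ Metric.closedBall (0 : ℂ) 1, ∀ z, ‖z - φ t‖ ≤ δ →
      z ∈ Metric.cthickening δ (φ '' Metric.closedBall 0 1) := by
    intro t ht z hz
    refine Metric.mem_cthickening_of_dist_le z (φ t) δ _ (mem_image_of_mem _ ht) ?_
    rwa [dist_eq_norm]
  obtain ⟨A, hA⟩ := (hu.upperSemicontinuousOn.mono hδΩ).exists_coe_bound
    (hBc.image_of_continuousOn hφc).cthickening fun z hz => hu.lt_top z (hδΩ hz)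
  have hHc : ContinuousOn H (Metric.closedBall 0 1) := by
    rw [← closure_ball _ one_ne_zero]; exact hH.continuousOn
  obtain ⟨M, hM⟩ := hBc.exists_bound_of_continuousOn hHc
  have hMre : ∀ t ∈ Metric.closedBall (0 : ℂ) 1, -M ≤ (H t).re := fun t ht =>
    (abs_le.1 ((Complex.abs_re_le_norm _).trans (hM t ht))).1
  refine le_of_forall_gt_imp_ge_of_dense fun c hc => ?_
  obtain ⟨c', hc1, hc2⟩ := EReal.lt_iff_exists_real_btwn.1 hc
  refine le_trans ?_ hc2.le
  rw [EReal.coe_lt_coe_iff] at hc1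
  set η := c' - (H 0).re with hη
  have hη0 : 0 < η := sub_pos.2 hc1
  have hc'η : c' = (H 0).re + η := by rw [hη]; ring
  clear_value η
  subst hc'η
  -- The maximum principle runs on a tube around the graph of `φ`, for `u z - N ‖z - φ t‖²`. In the
  -- tube one may move along affine discs, where the inequality for `u` is known; the penalty
  -- vanishes on the graph itself.
  let K : Set (E × ℂ) := {p | ‖p.2‖ ≤ 1 ∧ ‖p.1 - φ p.2‖ ≤ δ}
  have hK : IsCompact K := by
    have h1 : K = (fun q : E × ℂ => (q.1 + φ q.2, q.2)) ''
        (Metric.closedBall 0 δ ×ˢ Metric.closedBall 0 1) := by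
      ext ⟨z, t⟩
      simp only [K, mem_ofPred_eq, mem_image, mem_prod, mem_closedBall_zero_iff, Prod.exists,
        Prod.mk.injEq]
      constructor
      · rintro ⟨h1, h2⟩
        exact ⟨z - φ t, t, ⟨h2, h1⟩, by abel, rfl⟩
      · rintro ⟨w, s, ⟨h1, h2⟩, rfl, rfl⟩
        exact ⟨h2, by simpa using h1⟩
    rw [h1]
    refine ((isCompact_closedBall 0 δ).prod hBc).image_of_continuousOn ?_
    refine ContinuousOn.prodMk (continuousOn_fst.add (hφc.comp continuousOn_snd ?_))
      continuousOn_snd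
    intro q hq; exact hq.2
  have hKΩ : ∀ p ∈ K, p.1 ∈ Metric.cthickening δ (φ '' Metric.closedBall 0 1) := fun p hp =>
    hthick p.2 (by simpa using hp.1) _ hp.2
  have hgapc : ContinuousOn (fun p : E × ℂ => ‖p.1 - φ p.2‖) K :=
    (continuousOn_fst.sub (hφc.comp continuousOn_snd fun p hp => by simpa using hp.1)).norm
  have husc : UpperSemicontinuousOn (fun p : E × ℂ => u p.1) K :=
    hu.upperSemicontinuousOn.comp continuousOn_fst fun p hp => hδΩ (hKΩ p hp)
  have hHp : ContinuousOn (fun p : E × ℂ => (H p.2).re) K :=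
    Complex.continuous_re.comp_continuousOn
      (hHc.comp continuousOn_snd fun p hp => by simpa using hp.1)
  -- By upper semicontinuity and compactness, boundary points where `u` exceeds `Re H + η` stay at
  -- distance at least `γ` from the graph.
  obtain ⟨γ, hγ, hγS⟩ : ∃ γ > 0, ∀ p ∈ K, ‖p.2‖ = 1 →
      (((H p.2).re + η : ℝ) : EReal) ≤ u p.1 → γ ≤ ‖p.1 - φ p.2‖ := by
    have hK1 : IsCompact {p ∈ K | ‖p.2‖ = 1} :=
      hK.inter_right (isClosed_eq continuous_snd.norm continuous_const)
    have hsub1 : {p ∈ K | ‖p.2‖ = 1} ⊆ K := sep_subset _ _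
    have hS := ((husc.mono hsub1).add_coe (hHp.mono hsub1).neg).isCompact_inter_preimage_Ici
      hK1 (η : EReal)
    rcases (({p ∈ K | ‖p.2‖ = 1} ∩ (fun p : E × ℂ => u p.1 + ((-(H p.2).re : ℝ) : EReal)) ⁻¹'
      Ici (η : EReal))).eq_empty_or_nonempty with hemp | hne
    · refine ⟨1, one_pos, fun p hp hp1 hpu => ?_⟩
      exfalso
      have : p ∈ ({p ∈ K | ‖p.2‖ = 1} ∩
          (fun p : E × ℂ => u p.1 + ((-(H p.2).re : ℝ) : EReal)) ⁻¹' Ici (η : EReal)) := by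
        refine ⟨⟨hp, hp1⟩, ?_⟩
        rw [mem_preimage, mem_Ici]
        refine le_trans (le_of_eq ?_) (add_le_add_left hpu _)
        rw [← EReal.coe_add]; congr 1; ring
      rw [hemp] at this; exact this
    · obtain ⟨q, hq, hmin⟩ := hS.exists_isMinOn hne
        (hgapc.mono fun p hp => hp.1.1)
      refine ⟨‖q.1 - φ q.2‖, ?_, fun p hp hp1 hpu => hmin ⟨⟨hp, hp1⟩, ?_⟩⟩
      · refine norm_pos_iff.2 (sub_ne_zero.2 fun heq => ?_)
        have h1 : u q.1 ≤ ((H q.2).re : EReal) := by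
          rw [heq]; exact hle q.2 (by simpa using hq.1.2)
        have h2 : (η : EReal) ≤ u q.1 + ((-(H q.2).re : ℝ) : EReal) := hq.2
        have h3 := h2.trans (add_le_add_left h1 _)
        rw [← EReal.coe_add, EReal.coe_le_coe_iff] at h3
        linarith
      · rw [mem_preimage, mem_Ici]
        refine le_trans (le_of_eq ?_) (add_le_add_left hpu _)
        rw [← EReal.coe_add, EReal.coe_eq_coe_iff]
        change η = (H p.2).re + η + -(H p.2).re
        ring
  -- The penalty outweighs `u - Re H ≤ A + M` both at the bad points over the circle and on the side
  -- `‖z - φ t‖ = δ` of the tube.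
  obtain ⟨N, hN0, hNγ, hNδ⟩ : ∃ N : ℝ, 0 < N ∧ A + M ≤ N * γ ^ 2 ∧ A + M ≤ N * δ ^ 2 := by
    refine ⟨max 1 (max ((A + M) / γ ^ 2) ((A + M) / δ ^ 2)), by positivity, ?_, ?_⟩
    · rw [← div_le_iff₀ (by positivity)]
      exact (le_max_left _ _).trans (le_max_right _ _)
    · rw [← div_le_iff₀ (by positivity)]
      exact (le_max_right _ _).trans (le_max_right _ _)
  have hmain := le_re_of_local_sections (K := K) hK (T := Prod.snd) continuousOn_snd
    (fun p hp => hp.1) (f := fun p => u p.1 + ((-(N * ‖p.1 - φ p.2‖ ^ 2) : ℝ) : EReal))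
    (husc.add_coe (continuousOn_const.mul (hgapc.pow 2)).neg)
    (fun p hp => EReal.add_lt_top (hu.lt_top _ (hδΩ (hKΩ p hp))).ne (EReal.coe_ne_top _))
    (D := fun _ => 1) continuousOn_const (H := fun t => H t + (η : ℂ)) (hH.add_const _)
    (by
      intro p hp hp1
      rw [EReal.add_coe_le_coe_iff, Complex.add_re, Complex.ofReal_re]
      by_cases h : (((H p.2).re + η : ℝ) : EReal) ≤ u p.1
      · refine (hA _ (hKΩ p hp)).trans (EReal.coe_le_coe_iff.2 ?_)
        have h1 := hγS p hp hp1 h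
        have h2 := hMre p.2 (by simp [hp1])
        have h3 : N * γ ^ 2 ≤ N * ‖p.1 - φ p.2‖ ^ 2 := by gcongr
        linarith
      · refine (not_le.1 h).le.trans (EReal.coe_le_coe_iff.2 ?_)
        have : 0 ≤ N * ‖p.1 - φ p.2‖ ^ 2 := by positivity
        linarith)
    (by
      rintro ⟨z, t₀⟩ hp ht₀ - hfgt ε hε
      dsimp only at ht₀ hfgt ⊢
      have hzδ : ‖z - φ t₀‖ < δ := by
        refine lt_of_le_of_ne hp.2 fun h => ?_
        refine (not_le.2 hfgt) ?_
        rw [EReal.add_coe_le_coe_iff, h, Complex.add_re, Complex.ofReal_re]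
        refine (hA _ (hKΩ _ hp)).trans (EReal.coe_le_coe_iff.2 ?_)
        have := hMre t₀ (by simpa using ht₀.le)
        linarith
      have hVt : V ∈ 𝓝 t₀ := hV.mem_nhds (hVsub (by simpa using ht₀.le))
      obtain ⟨C, hC, hCt⟩ := exists_norm_taylor_remainder_le hVt hφ
      have hφt : ContinuousAt φ t₀ := (hφ.differentiableAt hVt).continuousAt
      have hgap : ∀ᶠ t in 𝓝 t₀, ‖z + (t - t₀) • deriv φ t₀ - φ t‖ < δ := by
        have : ContinuousAt (fun t => ‖z + (t - t₀) • deriv φ t₀ - φ t‖) t₀ := by fun_prop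
        refine this.eventually_lt_const ?_
        simpa using hzδ
      have ht1 : ∀ᶠ t in 𝓝 t₀, ‖t‖ < 1 := continuous_norm.continuousAt.eventually_lt_const ht₀
      obtain ⟨ρ, hρ, hρt⟩ := Metric.eventually_nhds_iff_ball.1
        ((hCt.and hgap).and (ht1.and (eventually_mem_set.2 hVt)))
      obtain ⟨r, hr, hrρ, hrε⟩ : ∃ r > 0, r < ρ ∧ N * C ^ 2 * r ^ 2 ≤ ε := by
        have h1 : Tendsto (fun r : ℝ => N * C ^ 2 * r ^ 2) (𝓝[>] 0) (𝓝 0) := by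
          have : Continuous (fun r : ℝ => N * C ^ 2 * r ^ 2) := by fun_prop
          simpa using (this.tendsto 0).mono_left nhdsWithin_le_nhds
        obtain ⟨r, h3, h1, h2⟩ := ((h1.eventually_le_const hε).and
          (eventually_mem_set.2 (Ioo_mem_nhdsGT hρ))).exists
        exact ⟨r, h1, h2, h3⟩
      have hball : Metric.closedBall t₀ r ⊆ Metric.ball t₀ ρ := Metric.closedBall_subset_ball hrρ
      -- The section is the affine disc through `z` parallel to the tangent of `φ`. Its distance
      -- vector to the graph is `A₀ - R t`, with `R` the holomorphic Taylor remainder.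
      refine ⟨r, hr, fun t => (z + (t - t₀) • deriv φ t₀, t), fun _ => 0, by simp, ?_,
        diffContOnCl_const, ?_⟩
      · intro t ht
        obtain ⟨⟨-, h2⟩, h3, -⟩ := hρt t (hball ht)
        exact ⟨⟨h3.le, h2.le⟩, rfl, by simp⟩
      intro G hG hGle
      let R : ℂ → E := fun t => φ t - φ t₀ - (t - t₀) • deriv φ t₀
      have hRd : DiffContOnCl ℂ R (Metric.ball t₀ r) := by
        refine DifferentiableOn.diffContOnCl_ball (U := Metric.ball t₀ ρ) ?_ hball
        intro t ht
        have h1 : DifferentiableAt ℂ φ t := by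
          refine hφ.differentiableAt (hV.mem_nhds ?_)
          exact mem_of_mem_nhds (hV.mem_nhds (hρt t ht).2.2)
        have h2 : DifferentiableAt ℂ R t :=
          (h1.sub_const _).sub ((differentiableAt_id.sub_const _).smul_const _)
        exact h2.differentiableWithinAt
      have hsub := hu.holomorphicSubmean (a := z - t₀ • deriv φ t₀) (b := deriv φ t₀) (c := t₀)
        hr (fun t ht => by
          have h1 := hρt t (hball ht)
          have h2 : z - t₀ • deriv φ t₀ + t • deriv φ t₀ = z + (t - t₀) • deriv φ t₀ := by
            rw [sub_smul]; abel
          rw [h2]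
          exact hδΩ (hthick t (by simpa using h1.2.1.le) _ h1.1.2.le))
      have hz2 : ∀ t, z - t₀ • deriv φ t₀ + t • deriv φ t₀ = z + (t - t₀) • deriv φ t₀ := by
        intro t; rw [sub_smul]; abel
      simp only [hz2] at hsub
      set A₀ := z - φ t₀ with hA₀
      -- Expanding `N ‖A₀ - R‖²`, the cross term is the real part of a holomorphic function because
      -- the inner product is linear in its second argument, and `N ‖R‖²` is at most `N C² r⁴`,
      -- which is within the allowed `ε r²`.
      let G₂ : ℂ → ℂ := fun t => G t + ((N * ‖A₀‖ ^ 2 + N * C ^ 2 * r ^ 4 : ℝ) : ℂ) -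
        ((2 * N : ℝ) : ℂ) * inner ℂ A₀ (R t)
      have hG₂re : ∀ t, (G₂ t).re = (G t).re + (N * ‖A₀‖ ^ 2 + N * C ^ 2 * r ^ 4) -
          2 * N * (inner ℂ A₀ (R t)).re := by
        intro t
        simp only [G₂, Complex.sub_re, Complex.add_re, Complex.ofReal_re, Complex.re_ofReal_mul]
      have hG₂ : DiffContOnCl ℂ G₂ (Metric.ball t₀ r) := by
        refine (hG.add_const _).sub (DiffContOnCl.const_smul ?_ ((2 * N : ℝ) : ℂ))
        exact (innerSL ℂ A₀).differentiable.comp_diffContOnCl hRd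
      have hfin := hsub G₂ hG₂ (fun t ht => by
        have h1 := hGle t ht
        have hcl := Metric.sphere_subset_closedBall ht
        rw [EReal.add_coe_le_coe_iff] at h1
        refine h1.trans (EReal.coe_le_coe_iff.2 ?_)
        rw [hG₂re]
        have h2 : z + (t - t₀) • deriv φ t₀ - φ t = A₀ - R t := by
          simp only [R, hA₀]; abel
        rw [h2, norm_sub_sq (𝕜 := ℂ)]
        have h3 : ‖R t‖ ≤ C * r ^ 2 := by
          have := (hρt t (hball hcl)).1.1
          rw [mem_sphere_iff_norm] at ht
          rwa [ht] at this
        have h4 : ‖R t‖ ^ 2 ≤ C ^ 2 * r ^ 4 := by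
          calc ‖R t‖ ^ 2 ≤ (C * r ^ 2) ^ 2 := by gcongr
            _ = _ := by ring
        have h5 : N * ‖R t‖ ^ 2 ≤ N * (C ^ 2 * r ^ 4) := by gcongr
        simp only [RCLike.re_to_complex]
        linarith)
      have hR0 : R t₀ = 0 := by simp [R]
      simp only [hG₂re, hR0, inner_zero_right, sub_self, zero_smul, add_zero] at hfin
      rw [EReal.add_coe_le_coe_iff]
      refine hfin.trans (EReal.coe_le_coe_iff.2 ?_)
      have : N * C ^ 2 * r ^ 2 * r ^ 2 ≤ ε * r ^ 2 := by gcongr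
      simp only [Complex.zero_re]
      linarith)
  have := hmain (φ 0, 0) ⟨by simp, by simpa using hδ.le⟩ one_ne_zero
  simpa using this

/-! ### From holomorphic majorants back to circle means -/

/-- Real parts of entire functions are uniformly dense in the continuous functions on the unit
circle. -/
theorem exists_differentiable_re_approx {g : ℂ → ℝ} (hg : Continuous g) {δ : ℝ} (hδ : 0 < δ) :
    ∃ p : ℂ → ℂ, Differentiable ℂ p ∧ ∀ t ∈ Metric.sphere (0 : ℂ) 1, |g t - (p t).re| ≤ δ := by
  let g' : C(AddCircle (1 : ℝ), ℂ) :=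
    ⟨fun x => (g (AddCircle.toCircle x : ℂ) : ℂ), by
      have := @AddCircle.continuous_toCircle 1
      fun_prop⟩
  have hmem : g' ∈ closure (Submodule.span ℂ (Set.range (@fourier 1)) : Set _) := by
    rw [← Submodule.topologicalClosure_coe, span_fourier_closure_eq_top]
    trivial
  obtain ⟨h, hh, hdist⟩ := Metric.mem_closure_iff.1 hmem δ hδ
  -- Nonnegative frequencies go into `P`, negative ones into the conjugate of `Q`; the real part of
  -- `P + conj Q` is that of the entire function `P + Q`.
  have hrep : ∃ P Q : ℂ → ℂ, Differentiable ℂ P ∧ Differentiable ℂ Q ∧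
      ∀ x : AddCircle (1 : ℝ), h x = P (AddCircle.toCircle x : ℂ) +
        starRingEnd ℂ (Q (AddCircle.toCircle x : ℂ)) := by
    refine Submodule.span_induction (p := fun h _ => ∃ P Q : ℂ → ℂ, Differentiable ℂ P ∧
      Differentiable ℂ Q ∧ ∀ x : AddCircle (1 : ℝ), h x = P (AddCircle.toCircle x : ℂ) +
        starRingEnd ℂ (Q (AddCircle.toCircle x : ℂ))) ?_ ?_ ?_ ?_ hh
    · rintro _ ⟨n, rfl⟩
      rcases n with k | k
      · refine ⟨fun z => z ^ k, fun _ => 0, by fun_prop, by fun_prop, fun x => ?_⟩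
        rw [fourier_apply, AddCircle.toCircle_zsmul]
        simp
      · refine ⟨fun _ => 0, fun z => z ^ (k + 1), by fun_prop, by fun_prop, fun x => ?_⟩
        rw [fourier_apply, AddCircle.toCircle_zsmul, zpow_negSucc, Circle.coe_inv_eq_conj]
        simp
    · exact ⟨fun _ => 0, fun _ => 0, by fun_prop, by fun_prop, by simp⟩
    · rintro h₁ h₂ - - ⟨P₁, Q₁, hP₁, hQ₁, e₁⟩ ⟨P₂, Q₂, hP₂, hQ₂, e₂⟩
      refine ⟨fun z => P₁ z + P₂ z, fun z => Q₁ z + Q₂ z, by fun_prop, by fun_prop, fun x => ?_⟩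
      rw [ContinuousMap.add_apply, e₁, e₂, map_add]
      ring
    · rintro c h₁ - ⟨P, Q, hP, hQ, e⟩
      refine ⟨fun z => c * P z, fun z => starRingEnd ℂ c * Q z, by fun_prop, by fun_prop,
        fun x => ?_⟩
      rw [ContinuousMap.smul_apply, e, map_mul, Complex.conj_conj, smul_eq_mul]
      ring
  obtain ⟨P, Q, hP, hQ, e⟩ := hrep
  refine ⟨fun z => P z + Q z, hP.add hQ, fun t ht => ?_⟩
  let z : Circle := ⟨t, ht⟩
  obtain ⟨x, hx⟩ : ∃ x : AddCircle (1 : ℝ), AddCircle.toCircle x = z :=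
    ⟨(AddCircle.homeomorphCircle one_ne_zero).symm z, by
      rw [← AddCircle.homeomorphCircle_apply one_ne_zero, Homeomorph.apply_symm_apply]⟩
  have hxt : (AddCircle.toCircle x : ℂ) = t := by rw [hx]
  have h1 : ‖g' x - h x‖ ≤ δ := by
    rw [← dist_eq_norm]; exact (ContinuousMap.dist_apply_le_dist x).trans hdist.le
  rw [e, hxt] at h1
  have h2 := (Complex.abs_re_le_norm _).trans h1
  simpa [g', hxt] using h2

/-- A continuous majorant is `δ`-close to the real part of an entire function; raised by `δ` this is
again a majorant, at a cost of at most `2δ` in the mean. -/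
theorem HolomorphicSubmean.le_circleAverage {u : ℂ → EReal} (hu : HolomorphicSubmean u 0 1)
    {g : ℂ → ℝ} (hg : Continuous g) (hle : ∀ t ∈ Metric.sphere (0 : ℂ) 1, u t ≤ (g t : EReal)) :
    u 0 ≤ ((Real.circleAverage g 0 1 : ℝ) : EReal) := by
  refine EReal.le_of_forall_lt_iff_le.1 fun c hc => ?_
  rw [EReal.coe_lt_coe_iff] at hc
  set δ := (c - Real.circleAverage g 0 1) / 2 with hδ
  have hδ0 : 0 < δ := by rw [hδ]; linarith
  obtain ⟨p, hp, hpg⟩ := exists_differentiable_re_approx hg hδ0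
  have hG : DiffContOnCl ℂ (fun t => p t + (δ : ℂ)) (Metric.ball 0 1) :=
    Differentiable.diffContOnCl (by fun_prop)
  have h1 := hu _ hG (fun t ht => (hle t ht).trans (EReal.coe_le_coe_iff.2 (by
    have := (abs_le.1 (hpg t ht)).2
    rw [Complex.add_re, Complex.ofReal_re]; linarith)))
  refine h1.trans (EReal.coe_le_coe_iff.2 ?_)
  rw [← circleAverage_re_eq one_pos hG]
  have hint : ∀ {q : ℂ → ℝ}, Continuous q → CircleIntegrable q 0 1 := fun hq =>
    hq.continuousOn.circleIntegrable zero_le_one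
  have h2 : Real.circleAverage (fun t => (p t + (δ : ℂ)).re) 0 1 ≤
      Real.circleAverage (fun t => g t + 2 * δ) 0 1 := by
    refine Real.circleAverage_mono (hint ?_) (hint (by fun_prop)) fun t ht => ?_
    · have := hp.continuous
      exact Complex.continuous_re.comp (by fun_prop)
    · rw [abs_one] at ht
      have := (abs_le.1 (hpg t ht)).1
      simp only [Complex.add_re, Complex.ofReal_re]; linarith
  rw [Real.circleAverage_fun_add (hint hg) (hint continuous_const), Real.circleAverage_const] at h2
  linarith

/-- An upper semicontinuous function on the unit circle that is `< ∞` is the limit of a decreasing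
sequence of continuous functions. -/
theorem exists_antitone_continuous_approx {f : ℂ → EReal}
    (hf : UpperSemicontinuousOn f (Metric.sphere (0 : ℂ) 1))
    (hf_top : ∀ t ∈ Metric.sphere (0 : ℂ) 1, f t < ⊤) :
    ∃ g : ℕ → ℂ → ℝ, (∀ n, Continuous (g n)) ∧ (∀ t, Antitone fun n => g n t) ∧
      (∃ A : ℝ, ∀ n t, g n t ≤ A) ∧
      (∀ n, ∀ t ∈ Metric.sphere (0 : ℂ) 1, f t ≤ (g n t : EReal)) ∧
      ∀ t ∈ Metric.sphere (0 : ℂ) 1,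
        Tendsto (fun n => (g n t : EReal)) atTop (𝓝 (f t)) := by
  obtain ⟨A₀, hA₀⟩ := hf.exists_coe_bound (isCompact_sphere 0 1) hf_top
  set A := max A₀ 0
  have hA : ∀ t ∈ Metric.sphere (0 : ℂ) 1, f t ≤ (A : EReal) := fun t ht =>
    (hA₀ t ht).trans (EReal.coe_le_coe_iff.2 (le_max_left _ _))
  have hA0 : 0 ≤ A := le_max_right _ _
  let S := Metric.sphere (0 : ℂ) 1
  have hSne : Nonempty S := ⟨⟨1, by simp [S]⟩⟩
  -- Truncation at `-n` makes the function real-valued; its sup-convolution with `n ‖·‖`, called `g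
  -- n` below, is then `n`-Lipschitz.
  let v : ℕ → S → ℝ := fun n s => (max (f s) ((-(n : ℝ) : ℝ) : EReal)).toReal
  have hv : ∀ n s, ((v n s : ℝ) : EReal) = max (f s) ((-(n : ℝ) : ℝ) : EReal) := by
    intro n s
    refine EReal.coe_toReal (max_lt (hf_top s s.2) (EReal.coe_lt_top _)).ne ?_
    exact (lt_of_lt_of_le (EReal.bot_lt_coe _) (le_max_right _ _)).ne'
  have hvA : ∀ n s, v n s ≤ A := by
    intro n s
    rw [← EReal.coe_le_coe_iff, hv]
    refine max_le (hA s s.2) (EReal.coe_le_coe_iff.2 ?_)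
    have : (0 : ℝ) ≤ n := n.cast_nonneg
    linarith
  have hbdd : ∀ (n : ℕ) (t : ℂ), BddAbove (range fun s : S => v n s - n * ‖t - s‖) := by
    intro n t
    refine ⟨A, ?_⟩
    rintro _ ⟨s, rfl⟩
    have : 0 ≤ (n : ℝ) * ‖t - s‖ := by positivity
    have := hvA n s
    linarith
  let g : ℕ → ℂ → ℝ := fun n t => ⨆ s : S, (v n s - n * ‖t - s‖)
  have hfg : ∀ n, ∀ t ∈ S, f t ≤ (g n t : EReal) := by
    intro n t ht
    have h1 : v n ⟨t, ht⟩ ≤ g n t := by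
      have := le_ciSup (hbdd n t) ⟨t, ht⟩
      simpa using this
    refine le_trans ?_ (EReal.coe_le_coe_iff.2 h1)
    rw [hv]
    exact le_max_left _ _
  refine ⟨g, fun n => ?_, fun t => antitone_nat_of_succ_le fun n => ?_, ⟨A, fun n t => ?_⟩, hfg,
    fun t ht => ?_⟩
  · have : LipschitzWith n (g n) := by
      refine LipschitzWith.of_le_add_mul _ fun t t' => ?_
      refine ciSup_le fun s => ?_
      have h1 := le_ciSup (hbdd n t') s
      have h2 : ‖t' - s‖ ≤ ‖t - s‖ + dist t t' := by
        rw [dist_eq_norm, norm_sub_rev t t']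
        calc ‖t' - s‖ = ‖(t - s) + (t' - t)‖ := by congr 1; ring
          _ ≤ _ := norm_add_le _ _
      have h3 : (n : ℝ) * ‖t' - s‖ ≤ n * (‖t - s‖ + dist t t') := by gcongr
      simp only [NNReal.coe_natCast]
      change v n s - n * ‖t - s‖ ≤ g n t' + n * dist t t'
      change v n s - n * ‖t' - s‖ ≤ g n t' at h1
      linarith
    exact this.continuous
  · refine ciSup_mono (hbdd n t) fun s => ?_
    have h1 : v (n + 1) s ≤ v n s := by
      rw [← EReal.coe_le_coe_iff, hv, hv]
      refine max_le_max le_rfl (EReal.coe_le_coe_iff.2 ?_)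
      push_cast; linarith
    have h2 : (n : ℝ) * ‖t - s‖ ≤ ((n + 1 : ℕ) : ℝ) * ‖t - s‖ := by
      gcongr; omega
    linarith
  · refine ciSup_le fun s => ?_
    have : 0 ≤ (n : ℝ) * ‖t - s‖ := by positivity
    have := hvA n s
    linarith
  · refine tendsto_order.2 ⟨fun a ha => Eventually.of_forall fun n => ha.trans_le (hfg n t ht),
      fun a ha => ?_⟩
    obtain ⟨c, hc1, hc2⟩ := EReal.lt_iff_exists_real_btwn.1 ha
    obtain ⟨δ, hδ, hδf⟩ := Metric.mem_nhdsWithin_iff.1 (hf t ht c hc1)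
    -- For such `n`, points within `δ` contribute at most `c` by semicontinuity and `-n ≤ c`;
    -- farther points contribute at most `A - n δ ≤ c`.
    filter_upwards [eventually_ge_atTop ⌈max (-c) ((A - c) / δ)⌉₊] with n hn
    have hn' : max (-c) ((A - c) / δ) ≤ n := Nat.ceil_le.1 hn
    have hn1 := (le_max_left _ _).trans hn'
    have hn2 := (le_max_right _ _).trans hn'
    rw [div_le_iff₀ hδ] at hn2
    refine lt_of_le_of_lt (EReal.coe_le_coe_iff.2 (ciSup_le fun s => ?_)) hc2
    by_cases hs : ‖t - s‖ < δ
    · have h1 : f s < c := hδf ⟨by rwa [Metric.mem_ball, dist_comm, dist_eq_norm], s.2⟩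
      have h2 : v n s ≤ c := by
        rw [← EReal.coe_le_coe_iff, hv]
        exact max_le h1.le (EReal.coe_le_coe_iff.2 (by linarith))
      have : 0 ≤ (n : ℝ) * ‖t - s‖ := by positivity
      linarith
    · have h1 : (n : ℝ) * δ ≤ n * ‖t - s‖ := by
        gcongr; exact not_lt.1 hs
      have := hvA n s
      linarith

/-- Along decreasing continuous majorants, dominated convergence handles the positive parts and
monotone convergence the negative parts. The latter may have infinite limit, but the former is
finite, so subtraction is continuous at the limit. -/
theorem HolomorphicSubmean.le_circleMean {E : Type*} [NormedAddCommGroup E] [NormedSpace ℂ E]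
    {u : E → EReal} {a b : E} (hu : HolomorphicSubmean (fun t => u (a + t • b)) 0 1)
    (husc : UpperSemicontinuousOn (fun t : ℂ => u (a + t • b)) (Metric.sphere 0 1))
    (hu_top : ∀ t ∈ Metric.sphere (0 : ℂ) 1, u (a + t • b) < ⊤) : u a ≤ circleMean u a b := by
  obtain ⟨g, hgc, hanti, ⟨A, hA⟩, hfg, hlim⟩ := exists_antitone_continuous_approx husc hu_top
  set μ := volume.restrict (Ioc 0 (2 * Real.pi)) with hμ
  let c : ℝ → ℂ := circleMap 0 1
  have hc : Continuous c := continuous_circleMap 0 1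
  have hcS : ∀ θ, c θ ∈ Metric.sphere (0 : ℂ) 1 := fun θ => circleMap_mem_sphere 0 zero_le_one θ
  have h1 : ∀ n, u a ≤ ((⨍⁻ θ, ENNReal.ofReal (g n (c θ)) ∂μ : ENNReal) : EReal) -
      ((⨍⁻ θ, ENNReal.ofReal (-g n (c θ)) ∂μ : ENNReal) : EReal) := by
    intro n
    have hcont : Continuous fun θ => g n (c θ) := (hgc n).comp hc
    rw [← coe_average_eq_sub ((hcont.integrableOn_Icc (a := 0) (b := 2 * Real.pi)).mono_set
      Ioc_subset_Icc_self)]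
    have := hu.le_circleAverage (hgc n) (hfg n)
    rw [Real.circleAverage_eq_intervalAverage, uIoc_of_le (by positivity)] at this
    simpa using this
  have hfin : ((μ univ)⁻¹ • μ) univ ≠ ⊤ := by
    have : IsFiniteMeasure ((μ univ)⁻¹ • μ) := inferInstance
    exact measure_ne_top _ _
  have hpos : Tendsto (fun n => ⨍⁻ θ, ENNReal.ofReal (g n (c θ)) ∂μ) atTop
      (𝓝 (⨍⁻ θ, (u (a + c θ • b)).toENNReal ∂μ)) := by
    refine tendsto_lintegral_of_dominated_convergence (fun _ => ENNReal.ofReal A)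
      (fun n => (ENNReal.continuous_ofReal.comp ((hgc n).comp hc)).measurable)
      (fun n => Eventually.of_forall fun θ => ENNReal.ofReal_le_ofReal (hA n _)) ?_
      (Eventually.of_forall fun θ => ?_)
    · rw [lintegral_const]
      exact ENNReal.mul_ne_top ENNReal.ofReal_ne_top hfin
    · have := (EReal.continuous_toENNReal.tendsto _).comp (hlim _ (hcS θ))
      simpa [Function.comp_def, EReal.toENNReal] using this
  have hneg : Tendsto (fun n => ⨍⁻ θ, ENNReal.ofReal (-g n (c θ)) ∂μ) atTop
      (𝓝 (⨍⁻ θ, (-u (a + c θ • b)).toENNReal ∂μ)) := by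
    refine lintegral_tendsto_of_tendsto_of_monotone
      (fun n => (ENNReal.continuous_ofReal.comp ((hgc n).comp hc).neg).measurable.aemeasurable)
      (Eventually.of_forall fun θ n m hnm => ENNReal.ofReal_le_ofReal
        (neg_le_neg (hanti _ hnm))) (Eventually.of_forall fun θ => ?_)
    have := (EReal.continuous_toENNReal.tendsto _).comp
      ((continuous_neg.tendsto _).comp (hlim _ (hcS θ)))
    simpa [Function.comp_def, EReal.toENNReal, ← EReal.coe_neg] using this
  have htop : (⨍⁻ θ, (u (a + c θ • b)).toENNReal ∂μ) ≠ ⊤ := by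
    refine ne_top_of_le_ne_top (ENNReal.mul_ne_top (a := ENNReal.ofReal A) ENNReal.ofReal_ne_top
      hfin) ?_
    rw [← lintegral_const]
    refine lintegral_mono fun θ => ?_
    refine (EReal.toENNReal_le_toENNReal ((hfg 0 _ (hcS θ)).trans
      (EReal.coe_le_coe_iff.2 (hA 0 _)))).trans (by simp [EReal.toENNReal])
  refine ge_of_tendsto' (f := fun n : ℕ => _) (x := atTop) ?_ h1
  have h2 := (continuous_coe_ennreal_ereal.tendsto _).comp hpos
  have h3 := (continuous_neg.tendsto _).comp ((continuous_coe_ennreal_ereal.tendsto _).comp hneg)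
  have h4 := (EReal.continuousAt_add (p := (((⨍⁻ θ, (u (a + c θ • b)).toENNReal ∂μ : ENNReal) :
    EReal), -((⨍⁻ θ, (-u (a + c θ • b)).toENNReal ∂μ : ENNReal) : EReal)))
    (Or.inl (by simpa using htop)) (Or.inl (EReal.coe_ennreal_ne_bot _))).tendsto.comp
    (h2.prodMk_nhds h3)
  exact h4

/-- A characterization of plurisubharmonicity by majorants on affine discs. -/
theorem isPlurisubharmonicOn_of_holomorphicSubmean {E : Type*} [NormedAddCommGroup E]
    [NormedSpace ℂ E] {u : E → EReal} {Ω : Set E} (husc : UpperSemicontinuousOn u Ω)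
    (hu_top : ∀ z ∈ Ω, u z < ⊤)
    (hu : ∀ a b : E, (∀ t : ℂ, ‖t‖ ≤ 1 → a + t • b ∈ Ω) →
      HolomorphicSubmean (fun t => u (a + t • b)) 0 1) : IsPlurisubharmonicOn u Ω where
  upperSemicontinuousOn := husc
  lt_top := hu_top
  le_circleMean a b h := by
    have hS : ∀ t ∈ Metric.sphere (0 : ℂ) 1, a + t • b ∈ Ω := fun t ht =>
      h t (by simpa using (mem_sphere_zero_iff_norm.1 ht).le)
    refine (hu a b h).le_circleMean (husc.comp (g := fun t : ℂ => a + t • b) ?_ hS)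
      fun t ht => hu_top _ (hS t ht)
    exact Continuous.continuousOn (by fun_prop)

/-! ### Finite fibres: injective derivatives and equality of dimensions -/

/-- The holomorphic inverse function theorem. -/
theorem ContDiffAt.exists_differentiableOn_rightInverse {E G : Type*} [NormedAddCommGroup E]
    [NormedSpace ℂ E] [CompleteSpace E] [NormedAddCommGroup G] [NormedSpace ℂ G] {Φ : E → G}
    {a : E} (hΦ : ContDiffAt ℂ 1 Φ a) {e : E ≃L[ℂ] G}
    (he : HasFDerivAt Φ (e : E →L[ℂ] G) a) {U : Set E} (hU : U ∈ 𝓝 a) :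
    ∃ τ : G → E, ∃ V : Set G, IsOpen V ∧ Φ a ∈ V ∧ DifferentiableOn ℂ τ V ∧ τ (Φ a) = a ∧
      (∀ y ∈ V, Φ (τ y) = y) ∧ MapsTo τ V U := by
  have hs : HasStrictFDerivAt Φ (e : E →L[ℂ] G) a := hΦ.hasStrictFDerivAt' he one_ne_zero
  have hτ : ContDiffAt ℂ 1 (hs.localInverse Φ e a) (Φ a) := hΦ.to_localInverse he one_ne_zero
  have h0 : hs.localInverse Φ e a (Φ a) = a := hs.localInverse_apply_image
  have h1 : ∀ᶠ y in 𝓝 (Φ a), DifferentiableAt ℂ (hs.localInverse Φ e a) y :=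
    (hτ.eventually (by simp)).mono fun y hy => hy.differentiableAt one_ne_zero
  have h2 : ∀ᶠ y in 𝓝 (Φ a), hs.localInverse Φ e a y ∈ U :=
    hτ.continuousAt (by rwa [h0])
  obtain ⟨V, hV, hVo, haV⟩ := mem_nhds_iff.1 ((h1.and h2).and hs.eventually_right_inverse)
  exact ⟨hs.localInverse Φ e a, V, hVo, haV, fun y hy => (hV hy).1.1.differentiableWithinAt, h0,
    fun y hy => (hV hy).2, fun y hy => (hV hy).1.2⟩

/-- A holomorphic map with finite fibres has an injective derivative somewhere. -/
theorem exists_injective_fderiv_of_finite_fibers {G : Type*} [NormedAddCommGroup G]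
    [NormedSpace ℂ G] (d : ℕ) : ∀ {E : Type*} [NormedAddCommGroup E] [NormedSpace ℂ E]
    [FiniteDimensional ℂ E], Module.finrank ℂ E = d → ∀ {F : E → G} {U : Set E}, IsOpen U →
    U.Nonempty → DifferentiableOn ℂ F U → (∀ y, (U ∩ F ⁻¹' {y}).Finite) →
    ∃ x ∈ U, Function.Injective (fderiv ℂ F x) := by
  induction d with
  | zero =>
    intro E _ _ _ hE F U _ hne _ _
    have : Subsingleton E := Module.finrank_zero_iff.1 hE
    obtain ⟨x, hx⟩ := hne
    exact ⟨x, hx, Function.injective_of_subsingleton _⟩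
  | succ d ih =>
    intro E _ _ _ hE F U hU hne hF hfin
    have : CompleteSpace E := FiniteDimensional.complete ℂ E
    have hnt : Nontrivial E := Module.nontrivial_of_finrank_pos (R := ℂ) (by omega)
    -- Otherwise `F` is constant on a ball, which is an infinite subset of a fibre.
    obtain ⟨x₀, hx₀, hFx₀⟩ : ∃ x ∈ U, fderiv ℂ F x ≠ 0 := by
      by_contra! hall
      obtain ⟨x, hx⟩ := hne
      obtain ⟨ρ, hρ, hρU⟩ := Metric.isOpen_iff.1 hU x hx
      refine (infinite_of_mem_nhds x (Metric.ball_mem_nhds x hρ)) ((hfin (F x)).subset ?_)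
      intro y hy
      refine ⟨hρU hy, ?_⟩
      exact Metric.isOpen_ball.is_const_of_fderiv_eq_zero (convex_ball x ρ).isPreconnected
        (hF.mono hρU) (fun z hz => hall z (hρU hz)) hy (Metric.mem_ball_self hρ)
    obtain ⟨v, hv⟩ : ∃ v, fderiv ℂ F x₀ v ≠ 0 := by
      by_contra! h
      exact hFx₀ (ContinuousLinearMap.ext h)
    obtain ⟨l, hl⟩ := SeparatingDual.exists_ne_zero (R := ℂ) hv
    let lam : E →L[ℂ] ℂ := l ∘L fderiv ℂ F x₀
    have hlv : lam v ≠ 0 := hl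
    let N := LinearMap.ker lam.toLinearMap
    let e₀ : E ≃ₗ[ℂ] N × ℂ :=
      { toFun := fun x => (⟨x - (lam x / lam v) • v, by
          rw [LinearMap.mem_ker]
          simp [hlv]⟩, lam x)
        map_add' := fun x y => by
          ext
          · simp only [map_add, add_div, add_smul, Prod.fst_add, Submodule.coe_add]
            abel
          · simp
        map_smul' := fun c x => by
          ext
          · simp only [map_smul, smul_eq_mul, RingHom.id_apply, Prod.smul_fst,
              Submodule.coe_smul, smul_sub, smul_smul, mul_div_assoc]
          · simp
        invFun := fun p => (p.1 : E) + (p.2 / lam v) • v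
        left_inv := fun x => by simp
        right_inv := fun p => by
          have h0 : lam (p.1 : E) = 0 := p.1.2
          ext
          · simp [h0, hlv]
          · simp [h0, hlv] }
    let e : E ≃L[ℂ] N × ℂ := e₀.toContinuousLinearEquiv
    let π : E →L[ℂ] N := (ContinuousLinearMap.fst ℂ N ℂ) ∘L (e : E →L[ℂ] N × ℂ)
    -- Local coordinates in which `l ∘ F` is the last coordinate. The induction hypothesis applies
    -- to `F` on a level set of `l ∘ F`, a piece of the `d`-dimensional space `N`.
    let Φ : E → N × ℂ := fun x => (π x, l (F x))
    have hFd : ∀ x ∈ U, HasFDerivAt F (fderiv ℂ F x) x := fun x hx =>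
      (hF.differentiableAt (hU.mem_nhds hx)).hasFDerivAt
    have hΦd : ∀ x ∈ U, HasFDerivAt Φ (π.prod (l ∘L fderiv ℂ F x)) x := fun x hx =>
      π.hasFDerivAt.prodMk (l.hasFDerivAt.comp x (hFd x hx))
    have hΦc : ContDiffAt ℂ 1 Φ x₀ :=
      π.contDiff.contDiffAt.prodMk
        (l.contDiff.contDiffAt.comp x₀ (hF.contDiffAt_one_complex hU hx₀))
    have hΦe : HasFDerivAt Φ (e : E →L[ℂ] N × ℂ) x₀ := by
      have h1 := hΦd x₀ hx₀
      have h2 : π.prod (l ∘L fderiv ℂ F x₀) = (e : E →L[ℂ] N × ℂ) := by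
        ext x <;> rfl
      rwa [h2] at h1
    obtain ⟨τ, V, hV, haV, hτd, -, hτ, hτU⟩ :=
      hΦc.exists_differentiableOn_rightInverse hΦe (hU.mem_nhds hx₀)
    set c₀ := l (F x₀)
    let ι : N → N × ℂ := fun n => (n, c₀)
    have hι : ∀ n, HasFDerivAt ι (ContinuousLinearMap.inl ℂ N ℂ) n := fun n =>
      hasFDerivAt_prodMk_left n c₀
    have hιc : Continuous ι := by fun_prop
    have hτd' : ∀ y ∈ V, HasFDerivAt τ (fderiv ℂ τ y) y := fun y hy =>
      (hτd.differentiableAt (hV.mem_nhds hy)).hasFDerivAt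
    have hF₂ : ∀ n ∈ ι ⁻¹' V, HasFDerivAt (fun n => F (τ (ι n)))
        (fderiv ℂ F (τ (ι n)) ∘L (fderiv ℂ τ (ι n) ∘L ContinuousLinearMap.inl ℂ N ℂ)) n :=
      fun n hn => (hFd _ (hτU hn)).comp n ((hτd' _ hn).comp n (hι n))
    have hNd : Module.finrank ℂ N = d := by
      have := e₀.finrank_eq
      rw [Module.finrank_prod, Module.finrank_self] at this
      omega
    have hinj : InjOn (fun n => τ (ι n)) (ι ⁻¹' V) := by
      intro n hn n' hn' h
      have := congrArg Φ h
      simp only [hτ _ hn, hτ _ hn'] at this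
      exact congrArg Prod.fst this
    obtain ⟨n, hn, hn_inj⟩ := ih hNd (F := fun n => F (τ (ι n))) (hV.preimage hιc)
      ⟨π x₀, haV⟩ (fun n hn => (hF₂ n hn).differentiableAt.differentiableWithinAt) (by
        intro y
        refine Set.Finite.of_finite_image (f := fun n => τ (ι n)) ((hfin y).subset ?_)
          (hinj.mono inter_subset_left)
        rintro _ ⟨n, ⟨hnV, hny⟩, rfl⟩
        exact ⟨hτU hnV, hny⟩)
    rw [(hF₂ n hn).fderiv] at hn_inj
    refine ⟨τ (ι n), hτU hn, ?_⟩
    have hcomp : ∀ p, (π (fderiv ℂ τ (ι n) p), l (fderiv ℂ F (τ (ι n)) (fderiv ℂ τ (ι n) p))) =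
        p := by
      have h1 := (hΦd _ (hτU hn)).comp (ι n) (hτd' _ hn)
      have h2 : HasFDerivAt (Φ ∘ τ) (ContinuousLinearMap.id ℂ (N × ℂ)) (ι n) :=
        (hasFDerivAt_id _).congr_of_eventuallyEq
          ((hV.eventually_mem hn).mono fun y hy => hτ y hy)
      intro p
      exact congrArg (fun A : N × ℂ →L[ℂ] N × ℂ => A p) (h1.unique h2)
    have hτinj : Function.Injective (fderiv ℂ τ (ι n)) := by
      intro p q h
      rw [← hcomp p, ← hcomp q, h]
    have hτsurj : Function.Surjective (fderiv ℂ τ (ι n)) := by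
      have := (LinearMap.injective_iff_surjective_of_finrank_eq_finrank
        (f := (fderiv ℂ τ (ι n)).toLinearMap) e₀.finrank_eq.symm).1 hτinj
      exact this
    -- A kernel vector of `F'` is annihilated by `l ∘ F'`, so it is tangent to the level set, where
    -- the derivative is already injective.
    rw [injective_iff_map_eq_zero]
    intro w hw
    obtain ⟨⟨a, b⟩, rfl⟩ := hτsurj w
    have hb : b = 0 := by
      have := congrArg Prod.snd (hcomp (a, b))
      simp only [hw, map_zero] at this
      exact this.symm
    subst hb
    have ha : a = 0 := (injective_iff_map_eq_zero _).1 hn_inj a hw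
    rw [ha]
    exact map_zero _

/-- An injective derivative bounds the source dimension by the target dimension. Conversely a
locally Lipschitz map does not raise Hausdorff dimension, and the image has interior. -/
theorem finrank_eq_of_finite_fibers {E G : Type*} [NormedAddCommGroup E] [NormedSpace ℂ E]
    [FiniteDimensional ℂ E] [NormedAddCommGroup G] [NormedSpace ℂ G] [FiniteDimensional ℂ G]
    {F : E → G} {U : Set E} (hU : IsOpen U) (hF : DifferentiableOn ℂ F U)
    (hfin : ∀ y, (U ∩ F ⁻¹' {y}).Finite) (himg : (interior (F '' U)).Nonempty) :
    Module.finrank ℂ E = Module.finrank ℂ G := by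
  have : FiniteDimensional ℝ E := FiniteDimensional.complexToReal E
  have : FiniteDimensional ℝ G := FiniteDimensional.complexToReal G
  have hne : U.Nonempty := (himg.mono interior_subset).of_image
  refine le_antisymm ?_ ?_
  · obtain ⟨x, -, hx⟩ := exists_injective_fderiv_of_finite_fibers _ rfl hU hne hF hfin
    exact LinearMap.finrank_le_finrank_of_injective (f := (fderiv ℂ F x).toLinearMap) hx
  · have h1 : dimH (F '' U) ≤ dimH U := by
      have : ProperSpace E := FiniteDimensional.proper ℂ E
      refine dimH_image_le_of_locally_lipschitzOn fun x hx => ?_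
      obtain ⟨C, t, ht, hC⟩ := (hF.contDiffAt_one_complex hU hx).exists_lipschitzOnWith
      exact ⟨C, t, mem_nhdsWithin_of_mem_nhds ht, hC⟩
    rw [Real.dimH_of_nonempty_interior himg,
      Real.dimH_of_nonempty_interior (by rwa [hU.interior_eq]), Nat.cast_le,
      finrank_real_of_complex, finrank_real_of_complex] at h1
    omega

/-! ### Lifting discs, crossing the critical set, and openness -/

/-- Local lifts of complex lines through a point where `F` is a local biholomorphism. -/
theorem exists_local_lift {E : Type*} [NormedAddCommGroup E] [NormedSpace ℂ E]
    [FiniteDimensional ℂ E] {F : E → E} {X : Set E} (hX : IsOpen X)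
    (hF : DifferentiableOn ℂ F X) {x : E} (hx : x ∈ X) (hJ : (fderiv ℂ F x).det ≠ 0) {y b : E}
    {t₀ : ℂ} (hFx : F x = y + t₀ • b) :
    ∃ ρ > 0, ∃ (ψ : ℂ → E) (L : ℂ → ℂ), ψ t₀ = x ∧ DifferentiableOn ℂ ψ (Metric.ball t₀ ρ) ∧
      DifferentiableOn ℂ L (Metric.ball t₀ ρ) ∧ ∀ t ∈ Metric.ball t₀ ρ,
        ψ t ∈ X ∧ F (ψ t) = y + t • b ∧ (fderiv ℂ F (ψ t)).det = Complex.exp (L t) := by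
  have : CompleteSpace E := FiniteDimensional.complete ℂ E
  let e : E ≃L[ℂ] E := (fderiv ℂ F x).toContinuousLinearEquivOfDetNeZero hJ
  have he : HasFDerivAt F (e : E →L[ℂ] E) x := by
    have : (e : E →L[ℂ] E) = fderiv ℂ F x := by ext; rfl
    rw [this]
    exact (hF.differentiableAt (hX.mem_nhds hx)).hasFDerivAt
  obtain ⟨τ, V, hV, haV, hτd, hτx, hτ, hτX⟩ :=
    (hF.contDiffAt_one_complex hX hx).exists_differentiableOn_rightInverse he (hX.mem_nhds hx)
  have hline : Differentiable ℂ fun t : ℂ => y + t • b := by fun_prop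
  let W := (fun t : ℂ => y + t • b) ⁻¹' V
  have hW : IsOpen W := hV.preimage hline.continuous
  have ht₀W : t₀ ∈ W := by
    change y + t₀ • b ∈ V
    rwa [← hFx]
  let ψ : ℂ → E := fun t => τ (y + t • b)
  have hψd : DifferentiableOn ℂ ψ W := hτd.comp hline.differentiableOn fun t ht => ht
  have hψX : MapsTo ψ W X := fun t ht => hτX ht
  have hψ0 : ψ t₀ = x := by simp only [ψ]; rw [← hFx, hτx]
  let j : ℂ → ℂ := fun t => (fderiv ℂ F (ψ t)).det
  have hjd : DifferentiableOn ℂ j W := hF.det_fderiv_comp_curve hX hW hψd hψX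
  have hj0 : j t₀ ≠ 0 := by simp only [j, hψ0]; exact hJ
  -- Normalising to the value 1 at `t₀` makes the principal logarithm holomorphic near `t₀`,
  -- wherever `j t₀` lies.
  have hslit : ∀ᶠ t in 𝓝 t₀, j t / j t₀ ∈ Complex.slitPlane := by
    have h1 : ContinuousAt (fun t => j t / j t₀) t₀ :=
      (hjd.differentiableAt (hW.mem_nhds ht₀W)).continuousAt.div_const _
    refine h1 (Complex.isOpen_slitPlane.mem_nhds ?_)
    simp only [div_self hj0]
    exact Complex.one_mem_slitPlane
  obtain ⟨ρ, hρ, hρt⟩ := Metric.eventually_nhds_iff_ball.1 (hslit.and (hW.eventually_mem ht₀W))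
  have hsub : Metric.ball t₀ ρ ⊆ W := fun t ht => (hρt t ht).2
  refine ⟨ρ, hρ, ψ, fun t => Complex.log (j t / j t₀) + Complex.log (j t₀), hψ0,
    hψd.mono hsub, ?_, fun t ht => ⟨hψX (hsub ht), hτ _ (hsub ht), ?_⟩⟩
  · intro t ht
    have h1 := (hjd.differentiableAt (hW.mem_nhds (hsub ht))).div_const (j t₀)
    exact ((h1.clog (hρt t ht).1).add_const _).differentiableWithinAt
  · rw [Complex.exp_add, Complex.exp_log (Complex.slitPlane_ne_zero (hρt t ht).1),
      Complex.exp_log hj0, div_mul_cancel₀ _ hj0]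

theorem HolomorphicSubmean.of_unit_disc {u : ℂ → EReal} {c : ℂ} {r : ℝ} (hr : 0 < r)
    (hu : HolomorphicSubmean (fun s => u (c + r * s)) 0 1) : HolomorphicSubmean u c r := by
  intro H hH hle
  have hnorm : ∀ s : ℂ, ‖c + r * s - c‖ = r * ‖s‖ := by
    intro s
    rw [add_sub_cancel_left, norm_mul, Complex.norm_real, Real.norm_of_nonneg hr.le]
  have hcomp : DiffContOnCl ℂ (fun s : ℂ => H (c + r * s)) (Metric.ball 0 1) := by
    have haff : Differentiable ℂ fun s : ℂ => c + r * s := by fun_prop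
    refine hH.comp haff.diffContOnCl fun s hs => ?_
    rw [mem_ball_zero_iff] at hs
    rw [mem_ball_iff_norm, hnorm]
    nlinarith
  have := hu _ hcomp fun s hs => hle _ (by
    rw [mem_sphere_zero_iff_norm] at hs
    rw [mem_sphere_iff_norm, hnorm, hs, mul_one])
  simpa using this

theorem isPlurisubharmonicOn_zero {E : Type*} [NormedAddCommGroup E] [NormedSpace ℂ E]
    (Ω : Set E) : IsPlurisubharmonicOn (fun _ : E => (0 : EReal)) Ω := by
  refine isPlurisubharmonicOn_of_holomorphicSubmean upperSemicontinuousOn_const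
    (fun _ _ => EReal.zero_lt_top) fun a b _ => ?_
  simpa using holomorphicSubmean_re (H := fun _ => 0) (c := 0) one_pos diffContOnCl_const

section Lifting

variable {E : Type*} [NormedAddCommGroup E] [InnerProductSpace ℂ E] [FiniteDimensional ℂ E]

/-- The maximum principle for a plurisubharmonic function on the preimage of a complex disc. -/
theorem IsPlurisubharmonicOn.le_re_of_mem_preimage_disc {F : E → E} {X : Set E} (hX : IsOpen X)
    (hF : DifferentiableOn ℂ F X) {f : E → EReal} (hf : IsPlurisubharmonicOn f X) {y b : E}
    (hK : IsCompact {p : E × ℂ | p.1 ∈ X ∧ ‖p.2‖ ≤ 1 ∧ F p.1 = y + p.2 • b}) {H : ℂ → ℂ}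
    (hH : DiffContOnCl ℂ H (Metric.ball 0 1))
    (hbdry : ∀ x ∈ X, ∀ t : ℂ, ‖t‖ = 1 → F x = y + t • b → f x ≤ ((H t).re : EReal))
    {x : E} (hx : x ∈ X) {t : ℂ} (ht : ‖t‖ ≤ 1) (hFx : F x = y + t • b)
    (hJ : (fderiv ℂ F x).det ≠ 0) : f x ≤ ((H t).re : EReal) := by
  -- The parameter `t` is kept as a coordinate, so the projection to the disc makes sense even for
  -- `b = 0`. The role of `D` is played by the Jacobian.
  refine le_re_of_local_sections hK (T := Prod.snd) continuousOn_snd (fun p hp => hp.2.1)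
    (f := fun p => f p.1) (hf.upperSemicontinuousOn.comp continuousOn_fst fun p hp => hp.1)
    (fun p hp => hf.lt_top _ hp.1) (D := fun p => (fderiv ℂ F p.1).det)
    ((hF.continuousOn_det_fderiv hX).comp continuousOn_fst fun p hp => hp.1) hH
    (fun p hp hp1 => hbdry _ hp.1 _ hp1 hp.2.2) ?_ (x, t) ⟨hx, ht, hFx⟩ hJ
  rintro ⟨x, t₀⟩ ⟨hx, -, hFx⟩ ht₀ hJ - ε hε
  dsimp only at hx hFx ht₀ hJ ⊢
  obtain ⟨ρ, hρ, ψ, L, hψ0, hψd, hLd, hψ⟩ := exists_local_lift hX hF hx hJ hFx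
  set r := min (ρ / 2) ((1 - ‖t₀‖) / 2) with hr
  have hr0 : 0 < r := lt_min (by positivity) (by linarith)
  have hrρ : Metric.closedBall t₀ r ⊆ Metric.ball t₀ ρ :=
    Metric.closedBall_subset_ball (by linarith [min_le_left (ρ / 2) ((1 - ‖t₀‖) / 2)])
  have hr1 : ∀ t ∈ Metric.closedBall t₀ r, ‖t‖ ≤ 1 := by
    intro t ht
    rw [mem_closedBall_iff_norm] at ht
    have := norm_sub_norm_le t t₀
    linarith [min_le_right (ρ / 2) ((1 - ‖t₀‖) / 2)]
  refine ⟨r, hr0, fun t => (ψ t, t), L, by simp only [hψ0], fun t ht => ⟨⟨(hψ t (hrρ ht)).1, hr1 t ht,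
    (hψ t (hrρ ht)).2.1⟩, rfl, (hψ t (hrρ ht)).2.2⟩, hLd.diffContOnCl_ball hrρ, ?_⟩
  intro G hG hle
  have haff : Differentiable ℂ fun s : ℂ => t₀ + r * s := by fun_prop
  have hmem : ∀ s ∈ Metric.closedBall (0 : ℂ) 1, t₀ + r * s ∈ Metric.ball t₀ ρ := by
    intro s hs
    refine hrρ ?_
    rw [mem_closedBall_zero_iff] at hs
    rw [mem_closedBall_iff_norm, add_sub_cancel_left, norm_mul, Complex.norm_real,
      Real.norm_of_nonneg hr0.le]
    nlinarith
  have hsub : HolomorphicSubmean (fun t => f (ψ t)) t₀ r :=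
    HolomorphicSubmean.of_unit_disc hr0 (hf.holomorphicSubmean_comp hX
      (φ := fun s : ℂ => ψ (t₀ + r * s)) (Metric.isOpen_ball.preimage haff.continuous)
      (hψd.comp haff.differentiableOn fun s hs => hs) hmem fun s hs => (hψ _ (hmem s hs)).1)
  have h1 := hsub G hG hle
  simp only [hψ0] at h1
  refine h1.trans (EReal.coe_le_coe_iff.2 ?_)
  have : 0 < ε * r ^ 2 := by positivity
  linarith

/-- A bound for a plurisubharmonic function off the critical set of a holomorphic map extends
across the critical set. -/
theorem IsPlurisubharmonicOn.le_of_eventually_le_of_det_ne_zero {F : E → E} {Ω : Set E}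
    (hΩ : IsOpen Ω) (hF : DifferentiableOn ℂ F Ω)
    (hdense : ∀ U ⊆ Ω, IsOpen U → U.Nonempty → ∃ x ∈ U, (fderiv ℂ F x).det ≠ 0) {f : E → EReal}
    (hf : IsPlurisubharmonicOn f Ω) {x₀ : E} (hx₀ : x₀ ∈ Ω) {C : ℝ}
    (hC : ∀ᶠ x in 𝓝 x₀, (fderiv ℂ F x).det ≠ 0 → f x ≤ C) : f x₀ ≤ C := by
  obtain ⟨ρ, hρ, hρx⟩ := Metric.eventually_nhds_iff_ball.1 (hC.and (hΩ.eventually_mem hx₀))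
  obtain ⟨x₁, hx₁, hJ₁⟩ := hdense (Metric.ball x₀ ρ) (fun x hx => (hρx x hx).2)
    Metric.isOpen_ball ⟨x₀, Metric.mem_ball_self hρ⟩
  -- On the complex line from `x₀` to a regular point the Jacobian is holomorphic and not
  -- identically zero. So some small circle about `x₀` in this line avoids the critical set, and the
  -- bound holds on it.
  set c := x₁ - x₀ with hc
  let ψ : ℂ → E := fun t => x₀ + t • c
  have hψ : Differentiable ℂ ψ := by fun_prop
  let V := ψ ⁻¹' Metric.ball x₀ ρ
  have hV : IsOpen V := Metric.isOpen_ball.preimage hψ.continuous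
  have hVc : IsPreconnected V := by
    have : Convex ℝ V := by
      intro s hs t ht α β hα hβ hαβ
      have h1 : ψ (α • s + β • t) = α • ψ s + β • ψ t := by
        simp only [ψ, smul_add, add_smul, smul_assoc]
        calc x₀ + (α • s • c + β • t • c)
            = (α + β) • x₀ + (α • s • c + β • t • c) := by rw [hαβ, one_smul]
          _ = _ := by rw [add_smul]; abel
      change ψ (α • s + β • t) ∈ Metric.ball x₀ ρ
      rw [h1]
      exact convex_ball x₀ ρ hs ht hα hβ hαβ
    exact this.isPreconnected
  have h0V : (0 : ℂ) ∈ V := by simp [V, ψ, hρ]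
  have h1ψ : ψ 1 = x₁ := by simp [ψ, hc]
  have h1V : (1 : ℂ) ∈ V := by
    change ψ 1 ∈ Metric.ball x₀ ρ
    rwa [h1ψ]
  have hj : AnalyticOnNhd ℂ (fun t => (fderiv ℂ F (ψ t)).det) V :=
    (hF.det_fderiv_comp_curve hΩ hV hψ.differentiableOn fun t ht => (hρx _ ht).2).analyticOnNhd hV
  rcases (hj 0 h0V).eventually_eq_zero_or_eventually_ne_zero with hz | hnz
  · exfalso
    refine hJ₁ ?_
    rw [← h1ψ]
    exact hj.eqOn_zero_of_preconnected_of_eventuallyEq_zero hVc h0V hz h1V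
  · rw [eventually_nhdsWithin_iff] at hnz
    obtain ⟨r, hr, hrt⟩ := Metric.eventually_nhds_iff_ball.1 (hnz.and (hV.eventually_mem h0V))
    have hr2 : Metric.closedBall (0 : ℂ) (r / 2) ⊆ Metric.ball 0 r :=
      Metric.closedBall_subset_ball (by linarith)
    have := hf.holomorphicSubmean (a := x₀) (b := c) (c := 0) (half_pos hr)
      (fun t ht => (hρx _ (hrt t (hr2 ht)).2).2) (fun _ => (C : ℂ)) diffContOnCl_const
      (fun t ht => by
        have h1 := hrt t (hr2 (Metric.sphere_subset_closedBall ht))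
        rw [Complex.ofReal_re]
        refine (hρx _ h1.2).1 (h1.1 ?_)
        rintro rfl
        rw [mem_sphere_zero_iff_norm, norm_zero] at ht
        linarith)
    simpa using this

/-- Compactness of the part over a small disc of the graph of a map that stays away from the disc on
the boundary sphere. -/
theorem isCompact_ball_preimage_disc {F : E → E} {x₁ y b : E} {ρ η : ℝ}
    (hFc : ContinuousOn F (Metric.closedBall x₁ ρ))
    (hsphere : ∀ x ∈ Metric.sphere x₁ ρ, η ≤ ‖F x - F x₁‖)
    (hdisc : ∀ t : ℂ, ‖t‖ ≤ 1 → ‖y + t • b - F x₁‖ < η) :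
    IsCompact {p : E × ℂ | p.1 ∈ Metric.ball x₁ ρ ∧ ‖p.2‖ ≤ 1 ∧ F p.1 = y + p.2 • b} := by
  have : ProperSpace E := FiniteDimensional.proper ℂ E
  have h1 : {p : E × ℂ | p.1 ∈ Metric.ball x₁ ρ ∧ ‖p.2‖ ≤ 1 ∧ F p.1 = y + p.2 • b} =
      (Metric.closedBall x₁ ρ ×ˢ Metric.closedBall (0 : ℂ) 1) ∩
        (fun p : E × ℂ => F p.1 - (y + p.2 • b)) ⁻¹' {0} := by
    ext ⟨x, t⟩
    simp only [mem_ofPred_eq, mem_inter_iff, mem_prod, mem_closedBall_zero_iff, mem_preimage,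
      mem_singleton_iff, sub_eq_zero]
    constructor
    · rintro ⟨h1, h2, h3⟩
      exact ⟨⟨Metric.ball_subset_closedBall h1, h2⟩, h3⟩
    · rintro ⟨⟨h1, h2⟩, h3⟩
      refine ⟨?_, h2, h3⟩
      rcases (Metric.mem_closedBall.1 h1).lt_or_eq with h | h
      · exact h
      · have h4 := hsphere x h
        rw [h3] at h4
        have := hdisc t h2
        linarith
  rw [h1]
  have hS : IsCompact (Metric.closedBall x₁ ρ ×ˢ Metric.closedBall (0 : ℂ) 1) :=
    (isCompact_closedBall _ _).prod (isCompact_closedBall _ _)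
  refine hS.of_isClosed_subset (ContinuousOn.preimage_isClosed_of_isClosed ?_ hS.isClosed
    isClosed_singleton) inter_subset_left
  refine (hFc.comp continuousOn_fst fun p hp => hp.1).sub ?_
  exact Continuous.continuousOn (by fun_prop)

/-- A holomorphic self-map of `ℂⁿ` that is nondegenerate on a dense set is open at a point that is
isolated in its fibre. -/
theorem exists_mem_ball_eq_of_isolated {F : E → E} {Ω : Set E}
    (hF : DifferentiableOn ℂ F Ω)
    (hdense : ∀ U ⊆ Ω, IsOpen U → U.Nonempty → ∃ x ∈ U, (fderiv ℂ F x).det ≠ 0) {x₁ : E} {ρ η : ℝ}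
    (hρ : 0 < ρ) (hη : 0 < η) (hsub : Metric.closedBall x₁ ρ ⊆ Ω)
    (hsphere : ∀ x ∈ Metric.sphere x₁ ρ, η ≤ ‖F x - F x₁‖) {y : E}
    (hy : ‖y - F x₁‖ < η / 4) : ∃ x ∈ Metric.ball x₁ ρ, F x = y := by
  have : ProperSpace E := FiniteDimensional.proper ℂ E
  by_contra! hnot
  have hFc : ContinuousOn F (Metric.closedBall x₁ ρ) := hF.continuousOn.mono hsub
  have hcl : IsClosed (F '' Metric.closedBall x₁ ρ) :=
    ((isCompact_closedBall x₁ ρ).image_of_continuousOn hFc).isClosed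
  have hyn : y ∉ F '' Metric.closedBall x₁ ρ := by
    rintro ⟨x, hx, rfl⟩
    rcases (Metric.mem_closedBall.1 hx).lt_or_eq with h | h
    · exact hnot x h rfl
    · have := hsphere x h
      linarith
  obtain ⟨δ, hδ, hδy⟩ := Metric.isOpen_iff.1 hcl.isOpen_compl y hyn
  have hx₁Ω : x₁ ∈ Ω := hsub (Metric.mem_closedBall_self hρ.le)
  have hballΩ : Metric.ball x₁ ρ ⊆ Ω := Metric.ball_subset_closedBall.trans hsub
  -- The disc `F x' + t b` runs from the regular value point `F x'` at `t = 0` to the missed point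
  -- `y` at `t = 1`; a whole neighbourhood of `y` is missed, so nothing lies over `t` near 1.
  obtain ⟨x', ⟨hx'ball, hx'F⟩, hJ'⟩ := hdense (Metric.ball x₁ ρ ∩ F ⁻¹' Metric.ball (F x₁) (η / 4))
    (inter_subset_left.trans hballΩ)
    ((hF.continuousOn.mono hballΩ).isOpen_inter_preimage Metric.isOpen_ball Metric.isOpen_ball)
    ⟨x₁, Metric.mem_ball_self hρ, Metric.mem_ball_self (by positivity)⟩
  rw [mem_preimage, mem_ball_iff_norm] at hx'F
  set b := y - F x' with hb
  have hbη : ‖b‖ < η / 2 := by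
    have h1 : b = (y - F x₁) - (F x' - F x₁) := by rw [hb]; abel
    rw [h1]
    exact (norm_sub_le _ _).trans_lt (by linarith)
  have hb0 : 0 < ‖b‖ := by
    rw [norm_pos_iff, hb, sub_ne_zero]
    rintro h
    exact hnot x' hx'ball h.symm
  have hdisc : ∀ t : ℂ, ‖t‖ ≤ 1 → ‖F x' + t • b - F x₁‖ < η := by
    intro t ht
    have h1 : F x' + t • b - F x₁ = (F x' - F x₁) + t • b := by abel
    rw [h1]
    refine (norm_add_le _ _).trans_lt ?_
    rw [norm_smul]
    nlinarith
  have hK := isCompact_ball_preimage_disc hFc hsphere hdisc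
  set d := δ ^ 2 / (2 * ‖b‖ ^ 2) with hd
  have hd0 : 0 < d := by positivity
  set s := min (d / 2) (1 / 4) with hs
  have hs0 : 0 < s := lt_min (by positivity) (by norm_num)
  have hs1 : s ≤ 1 / 4 := min_le_right _ _
  have hs2 : s ≤ d / 2 := min_le_left _ _
  have hne : ∀ t : ℂ, ‖t‖ ≤ 1 → (1 + s - t : ℂ) ≠ 0 := by
    intro t ht h
    have h1 : t = ((1 + s : ℝ) : ℂ) := by push_cast; linear_combination -h
    rw [h1, Complex.norm_real, Real.norm_of_nonneg (by positivity)] at ht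
    linarith
  -- On the unit circle `Re (1 - t)⁻¹ = 1/2`, so away from `t = 1` and for small `s` one has `Re H ≥
  -- 0`, whereas `Re H 0 ≤ 3/4 - 4/5 < 0`. The zero function, majorized on the boundary, then
  -- violates the maximum principle at `x'`.
  let H : ℂ → ℂ := fun t => 3 / 4 - (1 + s - t)⁻¹
  have hH : DiffContOnCl ℂ H (Metric.ball 0 1) := by
    refine DifferentiableOn.diffContOnCl_ball (U := Metric.closedBall 0 1) ?_ subset_rfl
    intro t ht
    have h1 := hne t (by simpa using ht)
    have h2 : DifferentiableAt ℂ H t := by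
      refine (differentiableAt_const _).sub (DifferentiableAt.inv ?_ h1)
      fun_prop
    exact h2.differentiableWithinAt
  have hfin := (isPlurisubharmonicOn_zero (Metric.ball x₁ ρ)).le_re_of_mem_preimage_disc
    Metric.isOpen_ball (hF.mono hballΩ) hK hH (fun x hx t ht hFx => by
      have h1 : δ ≤ ‖t - 1‖ * ‖b‖ := by
        by_contra! hlt
        refine absurd ⟨x, Metric.ball_subset_closedBall hx, rfl⟩
          (hδy (?_ : F x ∈ Metric.ball y δ))
        have h2 : F x - y = (t - 1) • b := by
          rw [hFx, hb, sub_smul, one_smul]; abel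
        rwa [mem_ball_iff_norm, h2, norm_smul]
      have h2 : ‖t - 1‖ ^ 2 = 2 * (1 - t.re) := by
        have h3 : t.re * t.re + t.im * t.im = 1 := by
          rw [← Complex.normSq_apply, Complex.normSq_eq_norm_sq, ht, one_pow]
        rw [← Complex.normSq_eq_norm_sq, Complex.normSq_apply]
        simp only [Complex.sub_re, Complex.one_re, Complex.sub_im, Complex.one_im]
        linarith
      have h3 : d ≤ 1 - t.re := by
        rw [hd, div_le_iff₀ (by positivity)]
        calc δ ^ 2 ≤ (‖t - 1‖ * ‖b‖) ^ 2 := by gcongr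
          _ = (1 - t.re) * (2 * ‖b‖ ^ 2) := by rw [mul_pow, h2]; ring
      have h4 : t.re * t.re + t.im * t.im = 1 := by
        rw [← Complex.normSq_apply, Complex.normSq_eq_norm_sq, ht, one_pow]
      have h5 : 0 < (1 + s - t.re) * (1 + s - t.re) + t.im * t.im := by nlinarith
      have h6 : (H t).re = 3 / 4 - (1 + s - t.re) /
          ((1 + s - t.re) * (1 + s - t.re) + t.im * t.im) := by
        have e1 : (1 + s - t : ℂ).re = 1 + s - t.re := by simp
        have e2 : (1 + s - t : ℂ).im = -t.im := by simp
        have e3 : (3 / 4 : ℂ) = ((3 / 4 : ℝ) : ℂ) := by norm_num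
        simp only [H]
        rw [Complex.sub_re, Complex.inv_re, Complex.normSq_apply, e1, e2, e3, Complex.ofReal_re,
          neg_mul_neg]
      rw [h6]
      refine EReal.coe_nonneg.2 (sub_nonneg.2 ?_)
      rw [div_le_iff₀ h5]
      nlinarith) hx'ball (t := 0) (by simp) (by simp) hJ'
  have h0 : (H 0).re = 3 / 4 - (1 + s)⁻¹ := by
    have : H 0 = ((3 / 4 - (1 + s)⁻¹ : ℝ) : ℂ) := by simp [H]
    rw [this, Complex.ofReal_re]
  rw [h0] at hfin
  have h1 : (0 : ℝ) ≤ 3 / 4 - (1 + s)⁻¹ := EReal.coe_nonneg.1 hfin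
  have h2 : (4 / 5 : ℝ) ≤ (1 + s)⁻¹ := by
    rw [le_inv_comm₀ (by norm_num) (by positivity)]
    norm_num
    linarith
  linarith

end Lifting

/-! ### Injective holomorphic maps have Lipschitz inverses -/

theorem exists_det_ne_zero_of_eventually {E : Type*} [NormedAddCommGroup E] [NormedSpace ℂ E]
    {F : E → E} {Ω : Set E} (hΩ : IsOpen Ω)
    (hdense : ∀ U ⊆ Ω, IsOpen U → U.Nonempty → ∃ x ∈ U, (fderiv ℂ F x).det ≠ 0) {x : E}
    (hx : x ∈ Ω) {P : E → Prop} (hP : ∀ᶠ z in 𝓝 x, P z) :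
    ∃ z, P z ∧ (fderiv ℂ F z).det ≠ 0 := by
  obtain ⟨U, hU, hUo, hxU⟩ := mem_nhds_iff.1 (hP.and (hΩ.eventually_mem hx))
  obtain ⟨z, hz, hJ⟩ := hdense U (fun z hz => (hU hz).2) hUo ⟨x, hxU⟩
  exact ⟨z, (hU hz).1, hJ⟩

theorem HasFDerivAt.exists_norm_sub_le {E G : Type*} [NormedAddCommGroup E] [NormedSpace ℂ E]
    [NormedAddCommGroup G] [NormedSpace ℂ G] {F : E → G} {e : E ≃L[ℂ] G} {x : E}
    (h : HasFDerivAt F (e : E →L[ℂ] G) x) :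
    ∃ C > 0, ∀ᶠ z in 𝓝 x, ‖z - x‖ ≤ C * ‖F z - F x‖ := by
  set S := ‖(e.symm : G →L[ℂ] E)‖ + 1 with hS
  have hS0 : 0 < S := by positivity
  refine ⟨2 * S, by positivity, ?_⟩
  filter_upwards [h.isLittleO.def (show 0 < 1 / (2 * S) by positivity)] with z hz
  have h1 : ‖z - x‖ ≤ S * ‖e (z - x)‖ := by
    calc ‖z - x‖ = ‖(e.symm : G →L[ℂ] E) (e (z - x))‖ := by simp
      _ ≤ ‖(e.symm : G →L[ℂ] E)‖ * ‖e (z - x)‖ := ContinuousLinearMap.le_opNorm _ _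
      _ ≤ S * ‖e (z - x)‖ := by gcongr; linarith
  have h2 : ‖e (z - x)‖ ≤ ‖F z - F x‖ + 1 / (2 * S) * ‖z - x‖ := by
    calc ‖e (z - x)‖ = ‖(F z - F x) - (F z - F x - e (z - x))‖ := by congr 1; abel
      _ ≤ ‖F z - F x‖ + ‖F z - F x - e (z - x)‖ := norm_sub_le _ _
      _ ≤ _ := by gcongr; exact hz
  have h3 : S * ‖e (z - x)‖ ≤ S * ‖F z - F x‖ + 1 / 2 * ‖z - x‖ := by
    calc S * ‖e (z - x)‖ ≤ S * (‖F z - F x‖ + 1 / (2 * S) * ‖z - x‖) := by gcongr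
      _ = _ := by field_simp
  linarith

section InverseLipschitz

variable {E : Type*} [NormedAddCommGroup E] [InnerProductSpace ℂ E] [FiniteDimensional ℂ E]

/-- A Schwarz-lemma bound for the inverse of an injective holomorphic map between regular points. -/
theorem norm_sub_le_of_injOn_of_det_ne_zero {F : E → E} {Ω : Set E}
    (hF : DifferentiableOn ℂ F Ω) {x₁ : E} {ρ η : ℝ} (hη : 0 < η)
    (hsub : Metric.closedBall x₁ ρ ⊆ Ω)
    (hsphere : ∀ x ∈ Metric.sphere x₁ ρ, η ≤ ‖F x - F x₁‖)
    (hinj : ∀ x ∈ Metric.ball x₁ ρ, ∀ x' ∈ Metric.ball x₁ ρ, ‖F x - F x₁‖ < η → F x = F x' →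
      x = x') {x x' : E} (hx : x ∈ Metric.ball x₁ ρ) (hx' : x' ∈ Metric.ball x₁ ρ)
    (hFx : ‖F x - F x₁‖ < η / 4) (hFx' : ‖F x' - F x₁‖ < η / 4)
    (hJ : (fderiv ℂ F x).det ≠ 0) (hJ' : (fderiv ℂ F x').det ≠ 0) :
    ‖x - x'‖ ≤ 4 * ρ / η * ‖F x - F x'‖ := by
  rcases eq_or_ne (F x) (F x') with heq | hne
  · rw [hinj x hx x' hx' (by linarith) heq]; simp
  have hballΩ : Metric.ball x₁ ρ ⊆ Ω := Metric.ball_subset_closedBall.trans hsub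
  have hFb : DifferentiableOn ℂ F (Metric.ball x₁ ρ) := hF.mono hballΩ
  have hρ : 0 < ρ := dist_nonneg.trans_lt hx
  set m := ‖F x - F x'‖ with hm
  have hm0 : 0 < m := norm_pos_iff.2 (sub_ne_zero.2 hne)
  have hmη : m < η / 2 := by
    have h1 : F x - F x' = (F x - F x₁) - (F x' - F x₁) := by abel
    rw [hm, h1]
    exact (norm_sub_le _ _).trans_lt (by linarith)
  -- The line through `F x'` and `F x` is scaled to a disc of radius `η / 2`, which stays in the
  -- `η`-ball about `F x₁`; `F x` then sits at the parameter `t₁ = 2 m / η`.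
  set b : E := ((η / (2 * m) : ℝ) : ℂ) • (F x - F x') with hb
  have hbn : ‖b‖ = η / 2 := by
    rw [hb, norm_smul, Complex.norm_real, Real.norm_of_nonneg (by positivity), ← hm]
    field_simp
  have hb0 : b ≠ 0 := by
    rw [← norm_pos_iff, hbn]; positivity
  set t₁ : ℝ := 2 * m / η with ht₁
  have ht₁0 : 0 < t₁ := by positivity
  have ht₁1 : t₁ < 1 := by rw [ht₁, div_lt_one hη]; linarith
  have hFxt : F x = F x' + (t₁ : ℂ) • b := by
    have h1 : (t₁ : ℂ) * ((η / (2 * m) : ℝ) : ℂ) = 1 := by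
      rw [← Complex.ofReal_mul, ht₁]
      have : 2 * m / η * (η / (2 * m)) = 1 := by field_simp
      rw [this, Complex.ofReal_one]
    rw [hb, smul_smul, h1, one_smul]; abel
  have hdisc : ∀ t : ℂ, ‖t‖ ≤ 1 → ‖F x' + t • b - F x₁‖ < η := by
    intro t ht
    have h1 : F x' + t • b - F x₁ = (F x' - F x₁) + t • b := by abel
    rw [h1]
    refine (norm_add_le _ _).trans_lt ?_
    rw [norm_smul, hbn]
    nlinarith
  have hK := isCompact_ball_preimage_disc (hF.continuousOn.mono hsub) hsphere hdisc
  set K := {p : E × ℂ | p.1 ∈ Metric.ball x₁ ρ ∧ ‖p.2‖ ≤ 1 ∧ F p.1 = F x' + p.2 • b} with hKdef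
  set a := x - x' with ha
  have he : HasFDerivAt F
      (((fderiv ℂ F x').toContinuousLinearEquivOfDetNeZero hJ' : E ≃L[ℂ] E) : E →L[ℂ] E) x' := by
    have h1 : (((fderiv ℂ F x').toContinuousLinearEquivOfDetNeZero hJ' : E ≃L[ℂ] E) : E →L[ℂ] E) =
      fderiv ℂ F x' := by ext; rfl
    rw [h1]
    exact (hFb.differentiableAt (Metric.isOpen_ball.mem_nhds hx')).hasFDerivAt
  obtain ⟨C, hC, hCz⟩ := he.exists_norm_sub_le
  -- The Schwarz quotient. Over `|t| = 1` it is at most `2 ρ ‖a‖`, while at `(x, t₁)` it equals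
  -- `‖a‖² / t₁`; the comparison gives `‖a‖ ≤ 2 ρ t₁ = 4 ρ m / η`.
  let q : E × ℂ → ℂ := fun p => inner ℂ a (p.1 - x') / p.2
  set B := ‖a‖ * (C * ‖b‖) with hB
  -- By injectivity only `x'` lies over `t = 0`. Since `F'` is invertible there, `B` bounds the
  -- quotient nearby, so this value makes `f` upper semicontinuous.
  let f : E × ℂ → EReal := fun p => if p.2 = 0 then (B : EReal) else ((q p).re : EReal)
  have hqle : ∀ p, (q p).re ≤ ‖a‖ * ‖p.1 - x'‖ / ‖p.2‖ := by
    intro p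
    refine (Complex.re_le_norm _).trans ?_
    rw [norm_div]
    gcongr
    exact norm_inner_le_norm _ _
  have hq : ∀ p : E × ℂ, p.2 ≠ 0 → ContinuousAt q p := by
    intro p hp
    refine ContinuousAt.div ?_ continuousAt_snd hp
    exact (Continuous.inner continuous_const (by fun_prop)).continuousAt
  have hK0 : ∀ p ∈ K, p.2 = 0 → p.1 = x' := by
    rintro ⟨z, t⟩ ⟨h1, -, h3⟩ rfl
    rw [zero_smul, add_zero] at h3
    exact hinj z h1 x' hx' (by rw [h3]; linarith) h3
  have hf : UpperSemicontinuousOn f K := by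
    intro p hp
    by_cases hp0 : p.2 = 0
    · intro c hc
      have hpx := hK0 p hp hp0
      have hfp : f p = B := by simp only [f, hp0, if_true]
      rw [hfp] at hc
      have h1 : ∀ᶠ p' : E × ℂ in 𝓝 p, ‖p'.1 - x'‖ ≤ C * ‖F p'.1 - F x'‖ := by
        rw [← hpx] at hCz
        simpa only [hpx] using (continuousAt_fst (p := p)).eventually hCz
      filter_upwards [mem_nhdsWithin_of_mem_nhds h1, self_mem_nhdsWithin] with p' hp'1 hp'K
      refine lt_of_le_of_lt ?_ hc
      by_cases hp'0 : p'.2 = 0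
      · simp only [f, hp'0, if_true]; exact le_rfl
      · simp only [f, if_neg hp'0]
        refine EReal.coe_le_coe_iff.2 ((hqle p').trans ?_)
        rw [div_le_iff₀ (norm_pos_iff.2 hp'0)]
        rw [hp'K.2.2, add_sub_cancel_left, norm_smul] at hp'1
        calc ‖a‖ * ‖p'.1 - x'‖ ≤ ‖a‖ * (C * (‖p'.2‖ * ‖b‖)) := by gcongr
          _ = _ := by rw [hB]; ring
    · refine ContinuousWithinAt.upperSemicontinuousWithinAt (ContinuousAt.continuousWithinAt ?_)
      have h1 : ContinuousAt (fun p => ((q p).re : EReal)) p :=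
        continuous_coe_real_ereal.continuousAt.comp
          (Complex.continuous_re.continuousAt.comp (hq p hp0))
      refine h1.congr ?_
      filter_upwards [continuousAt_snd.eventually_ne hp0] with p' hp'
      simp only [f, if_neg hp']
  have key := le_re_of_local_sections hK (T := Prod.snd) continuousOn_snd (fun p hp => hp.2.1)
    (f := f) hf
    (fun p hp => by simp only [f]; split_ifs <;> exact EReal.coe_lt_top _)
    -- The factor `t` excludes the exceptional fibre over `0` together with the critical points.
    (D := fun p => p.2 * (fderiv ℂ F p.1).det)
    (continuousOn_snd.mul ((hFb.continuousOn_det_fderiv Metric.isOpen_ball).comp continuousOn_fst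
      fun p hp => hp.1)) (H := fun _ => ((2 * ρ * ‖a‖ : ℝ) : ℂ)) diffContOnCl_const
    (fun p hp hp1 => by
      have hp0 : p.2 ≠ 0 := by
        rw [← norm_pos_iff, hp1]; exact one_pos
      simp only [f, if_neg hp0, Complex.ofReal_re]
      refine EReal.coe_le_coe_iff.2 ((hqle p).trans ?_)
      rw [hp1, div_one, mul_comm]
      have h1 : ‖p.1 - x'‖ ≤ 2 * ρ := by
        have h2 := mem_ball_iff_norm.1 hp.1
        have h3 := mem_ball_iff_norm.1 hx'
        have h4 : p.1 - x' = (p.1 - x₁) - (x' - x₁) := by abel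
        rw [h4]
        exact (norm_sub_le _ _).trans (by linarith)
      gcongr) (by
    rintro ⟨z, t₀⟩ ⟨hz, -, hFz⟩ ht₀ hD - ε hε
    dsimp only at hz hFz ht₀ hD ⊢
    have ht₀0 : t₀ ≠ 0 := left_ne_zero_of_mul hD
    obtain ⟨σ, hσ, ψ, L, hψ0, hψd, hLd, hψ⟩ := exists_local_lift Metric.isOpen_ball hFb hz
      (right_ne_zero_of_mul hD) hFz
    have ht₀n : 0 < ‖t₀‖ := norm_pos_iff.2 ht₀0
    obtain ⟨r, hr0, hr1, hr2, hr3⟩ : ∃ r > 0, r < σ ∧ r < 1 - ‖t₀‖ ∧ r < ‖t₀‖ := by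
      have h1 : 0 < min σ (min (1 - ‖t₀‖) ‖t₀‖) :=
        lt_min hσ (lt_min (by linarith) ht₀n)
      obtain ⟨r, hr, hr'⟩ := exists_between h1
      rw [lt_min_iff, lt_min_iff] at hr'
      exact ⟨r, hr, hr'.1, hr'.2.1, hr'.2.2⟩
    have hrσ : Metric.closedBall t₀ r ⊆ Metric.ball t₀ σ := Metric.closedBall_subset_ball hr1
    have hr1 : ∀ t ∈ Metric.closedBall t₀ r, ‖t‖ ≤ 1 := by
      intro t ht
      rw [mem_closedBall_iff_norm] at ht
      have := norm_sub_norm_le t t₀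
      linarith
    have hslit : ∀ t ∈ Metric.closedBall t₀ r, t / t₀ ∈ Complex.slitPlane := by
      intro t ht
      refine Complex.ball_one_subset_slitPlane ?_
      rw [mem_closedBall_iff_norm] at ht
      rw [mem_ball_iff_norm, div_sub_one ht₀0, norm_div, div_lt_one ht₀n]
      linarith
    have hnz : ∀ t ∈ Metric.closedBall t₀ r, t ≠ 0 := by
      rintro t ht rfl
      rw [mem_closedBall_iff_norm, zero_sub, norm_neg] at ht
      linarith
    refine ⟨r, hr0, fun t => (ψ t, t), fun t => Complex.log (t / t₀) + Complex.log t₀ + L t,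
      by simp only [hψ0], fun t ht => ⟨⟨(hψ t (hrσ ht)).1, hr1 t ht, (hψ t (hrσ ht)).2.1⟩, rfl, ?_⟩,
      ?_, ?_⟩
    · simp only
      rw [Complex.exp_add, Complex.exp_add, Complex.exp_log (Complex.slitPlane_ne_zero (hslit t ht)),
        Complex.exp_log ht₀0, div_mul_cancel₀ _ ht₀0, (hψ t (hrσ ht)).2.2]
    · refine DifferentiableOn.diffContOnCl_ball (U := Metric.closedBall t₀ r) ?_ subset_rfl
      refine DifferentiableOn.add (DifferentiableOn.add_const _ fun t ht => ?_) (hLd.mono hrσ)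
      exact ((differentiableAt_id.div_const t₀).clog (hslit t ht)).differentiableWithinAt
    · intro G hG hle
      have hQ : DiffContOnCl ℂ (fun t => q (ψ t, t)) (Metric.ball t₀ r) := by
        refine DifferentiableOn.diffContOnCl_ball (U := Metric.closedBall t₀ r) ?_ subset_rfl
        refine DifferentiableOn.div ?_ differentiableOn_id hnz
        exact (innerSL ℂ a).differentiable.comp_differentiableOn
          ((hψd.mono hrσ).sub_const x')
      have h1 := holomorphicSubmean_re hr0 hQ G hG (fun t ht => by
        have h2 := hle t ht
        simp only [f, if_neg (hnz t (Metric.sphere_subset_closedBall ht))] at h2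
        exact h2)
      simp only [hψ0] at h1
      simp only [f, if_neg ht₀0]
      refine h1.trans (EReal.coe_le_coe_iff.2 ?_)
      have : 0 < ε * r ^ 2 := by positivity
      linarith)
  have ht₁c : (t₁ : ℂ) ≠ 0 := by exact_mod_cast ht₁0.ne'
  have hfin := key (x, (t₁ : ℂ)) ⟨hx, by
    rw [Complex.norm_real, Real.norm_of_nonneg ht₁0.le]; exact ht₁1.le, hFxt⟩
    (mul_ne_zero ht₁c hJ)
  simp only [f, if_neg ht₁c, Complex.ofReal_re, EReal.coe_le_coe_iff, q] at hfin
  rw [← ha, inner_self_eq_norm_sq_to_K, Complex.div_ofReal_re] at hfin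
  have hre : ((‖a‖ : ℂ) ^ 2).re = ‖a‖ ^ 2 := by
    rw [← Complex.ofReal_pow, Complex.ofReal_re]
  simp only [Complex.coe_algebraMap, hre] at hfin
  rw [div_le_iff₀ ht₁0] at hfin
  have hfin2 : ‖a‖ * ‖a‖ ≤ (2 * ρ * t₁) * ‖a‖ := by nlinarith
  have h4 : 4 * ρ / η * m = 2 * ρ * t₁ := by rw [ht₁]; ring
  rw [h4]
  rcases (norm_nonneg a).eq_or_lt with h0 | h0
  · rw [← h0]; positivity
  · exact le_of_mul_le_mul_right hfin2 h0

/-- Both points may be critical: regular points are dense and the failure of the inequality is an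
open condition, so it would persist at a pair of regular points. -/
theorem norm_sub_le_of_injOn {F : E → E} {Ω : Set E} (hΩ : IsOpen Ω)
    (hF : DifferentiableOn ℂ F Ω)
    (hdense : ∀ U ⊆ Ω, IsOpen U → U.Nonempty → ∃ x ∈ U, (fderiv ℂ F x).det ≠ 0)
    {x₁ : E} {ρ η : ℝ} (hη : 0 < η) (hsub : Metric.closedBall x₁ ρ ⊆ Ω)
    (hsphere : ∀ x ∈ Metric.sphere x₁ ρ, η ≤ ‖F x - F x₁‖)
    (hinj : ∀ x ∈ Metric.ball x₁ ρ, ∀ x' ∈ Metric.ball x₁ ρ, ‖F x - F x₁‖ < η → F x = F x' →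
      x = x') {x : E} (hx : x ∈ Metric.ball x₁ ρ) (hFx : ‖F x - F x₁‖ < η / 4) :
    ‖x - x₁‖ ≤ 4 * ρ / η * ‖F x - F x₁‖ := by
  have hρ : 0 < ρ := dist_nonneg.trans_lt hx
  have hballΩ : Metric.ball x₁ ρ ⊆ Ω := Metric.ball_subset_closedBall.trans hsub
  have hcont : ∀ z ∈ Metric.ball x₁ ρ, ContinuousAt F z := fun z hz =>
    (hF.differentiableAt (hΩ.mem_nhds (hballΩ hz))).continuousAt
  have hx₁ : x₁ ∈ Metric.ball x₁ ρ := Metric.mem_ball_self hρ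
  have hnear : ∀ z ∈ Metric.ball x₁ ρ, ‖F z - F x₁‖ < η / 4 →
      ∀ᶠ z' in 𝓝 z, z' ∈ Metric.ball x₁ ρ ∧ ‖F z' - F x₁‖ < η / 4 := fun z hz hFz =>
    (Metric.isOpen_ball.eventually_mem hz).and
      (((hcont z hz).sub continuousAt_const).norm.eventually_lt_const hFz)
  by_contra! hlt
  have h1 : ContinuousAt (fun p : E × E => 4 * ρ / η * ‖F p.1 - F p.2‖ - ‖p.1 - p.2‖) (x, x₁) := by
    have e1 : ContinuousAt (fun p : E × E => F p.1) (x, x₁) :=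
      ContinuousAt.comp (f := Prod.fst) (hcont x hx) continuousAt_fst
    have e2 : ContinuousAt (fun p : E × E => F p.2) (x, x₁) :=
      ContinuousAt.comp (f := Prod.snd) (hcont x₁ hx₁) continuousAt_snd
    fun_prop
  have h2 := h1.eventually_lt_const (sub_neg.2 hlt)
  rw [nhds_prod_eq] at h2
  obtain ⟨P, hP, Q, hQ, hPQ⟩ := eventually_prod_iff.1 h2
  obtain ⟨z, ⟨hz1, hz2, hz3⟩, hzJ⟩ := exists_det_ne_zero_of_eventually hΩ hdense (hballΩ hx)
    (hP.and (hnear x hx hFx))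
  obtain ⟨z', ⟨hz'1, hz'2, hz'3⟩, hz'J⟩ := exists_det_ne_zero_of_eventually hΩ hdense (hballΩ hx₁)
    (hQ.and (hnear x₁ hx₁ (by rw [sub_self, norm_zero]; positivity)))
  have h3 := norm_sub_le_of_injOn_of_det_ne_zero hF hη hsub hsphere hinj hz2 hz'2 hz3 hz'3 hzJ hz'J
  have h4 := hPQ hz1 hz'1
  simp only at h4
  linarith

end InverseLipschitz

/-! ### Proper maps and push-forward of plurisubharmonic functions -/

section ProperMaps

variable {E G : Type*} [NormedAddCommGroup E] [NormedAddCommGroup G] {Ω₁ : Set E} {Ω₂ : Set G}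
  {F : E → G}

/-- A neighbourhood of a fibre of a proper map contains the nearby fibres. -/
theorem eventually_fiber_of_isProperMap (hmaps : MapsTo F Ω₁ Ω₂)
    (hproper : IsProperMap (hmaps.restrict F Ω₁ Ω₂)) (hΩ₂ : IsOpen Ω₂) {y : G} (hy : y ∈ Ω₂)
    {P : E → Prop} (hP : ∀ x ∈ Ω₁, F x = y → ∀ᶠ z in 𝓝 x, P z) :
    ∀ᶠ y' in 𝓝 y, ∀ x ∈ Ω₁, F x = y' → P x := by
  -- The bad set is closed, so its image under the closed map `F` is closed, and it misses `y`.
  let A : Set Ω₁ := {x | ¬ ∀ᶠ z in 𝓝 (x : E), P z}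
  have hA : IsClosed A := by
    rw [← isOpen_compl_iff]
    have : Aᶜ = Subtype.val ⁻¹' {x : E | ∀ᶠ z in 𝓝 x, P z} := by
      ext x; simp [A]
    rw [this]
    exact isOpen_setOfPred_eventually_nhds.preimage continuous_subtype_val
  have hcl := hproper.isClosedMap A hA
  have hy' : (⟨y, hy⟩ : Ω₂) ∉ hmaps.restrict F Ω₁ Ω₂ '' A := by
    rintro ⟨x, hx, hxy⟩
    exact hx (hP x x.2 (congrArg Subtype.val hxy))
  have h1 := hcl.isOpen_compl.mem_nhds hy'
  rw [mem_nhds_subtype_iff_nhdsWithin, hΩ₂.nhdsWithin_eq hy] at h1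
  filter_upwards [h1] with y' hy' x hx hxy
  by_contra hPx
  obtain ⟨z, hz, hzy⟩ := hy'
  refine hz ⟨⟨x, hx⟩, fun h => hPx h.self_of_nhds, ?_⟩
  refine Subtype.ext ?_
  rw [hzy]
  exact hxy

theorem isCompact_preimage_disc_of_isProperMap [NormedSpace ℂ G] (hmaps : MapsTo F Ω₁ Ω₂)
    (hproper : IsProperMap (hmaps.restrict F Ω₁ Ω₂)) (hF : ContinuousOn F Ω₁) {y b : G}
    (hdisc : ∀ t : ℂ, ‖t‖ ≤ 1 → y + t • b ∈ Ω₂) :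
    IsCompact {p : E × ℂ | p.1 ∈ Ω₁ ∧ ‖p.2‖ ≤ 1 ∧ F p.1 = y + p.2 • b} := by
  let D : Set G := (fun t : ℂ => y + t • b) '' Metric.closedBall 0 1
  have hD : IsCompact D := (isCompact_closedBall 0 1).image (by fun_prop)
  have hDΩ : D ⊆ Ω₂ := by
    rintro _ ⟨t, ht, rfl⟩
    exact hdisc t (by simpa using ht)
  have hD' : IsCompact ((Subtype.val : Ω₂ → G) ⁻¹' D) := by
    rw [Subtype.isCompact_iff, Subtype.image_preimage_coe, inter_eq_right.2 hDΩ]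
    exact hD
  have hC := (hproper.isCompact_preimage hD').image continuous_subtype_val
  set C := Subtype.val '' (hmaps.restrict F Ω₁ Ω₂ ⁻¹' ((Subtype.val : Ω₂ → G) ⁻¹' D)) with hCdef
  have hCΩ : C ⊆ Ω₁ := by
    rintro _ ⟨x, -, rfl⟩
    exact x.2
  have hS : IsCompact (C ×ˢ Metric.closedBall (0 : ℂ) 1) := hC.prod (isCompact_closedBall 0 1)
  have h1 : {p : E × ℂ | p.1 ∈ Ω₁ ∧ ‖p.2‖ ≤ 1 ∧ F p.1 = y + p.2 • b} =
      (C ×ˢ Metric.closedBall (0 : ℂ) 1) ∩ (fun p : E × ℂ => F p.1 - (y + p.2 • b)) ⁻¹' {0} := by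
    ext ⟨x, t⟩
    simp only [mem_ofPred_eq, mem_inter_iff, mem_prod, mem_closedBall_zero_iff, mem_preimage,
      mem_singleton_iff, sub_eq_zero]
    constructor
    · rintro ⟨h1, h2, h3⟩
      refine ⟨⟨⟨⟨x, h1⟩, ?_, rfl⟩, h2⟩, h3⟩
      exact ⟨t, by simpa using h2, h3.symm⟩
    · rintro ⟨⟨h1, h2⟩, h3⟩
      exact ⟨hCΩ h1, h2, h3⟩
  rw [h1]
  refine hS.of_isClosed_subset (ContinuousOn.preimage_isClosed_of_isClosed ?_ hS.isClosed
    isClosed_singleton) inter_subset_left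
  refine ((hF.mono hCΩ).comp continuousOn_fst fun p hp => hp.1).sub ?_
  exact Continuous.continuousOn (by fun_prop)

end ProperMaps

/-- The push-forward of a function by the supremum over the fibres in `Ω`. -/
noncomputable def fiberSup {X Y : Type*} (F : X → Y) (Ω : Set X) (f : X → EReal) (y : Y) : EReal :=
  ⨆ x ∈ Ω ∩ F ⁻¹' {y}, f x

theorem le_fiberSup {X Y : Type*} {F : X → Y} {Ω : Set X} (f : X → EReal) {x : X} (hx : x ∈ Ω) :
    f x ≤ fiberSup F Ω f (F x) :=
  le_iSup₂ (f := fun x (_ : x ∈ Ω ∩ F ⁻¹' {F _}) => f x) x ⟨hx, rfl⟩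

theorem fiberSup_le_iff {X Y : Type*} {F : X → Y} {Ω : Set X} {f : X → EReal} {y : Y}
    {c : EReal} : fiberSup F Ω f y ≤ c ↔ ∀ x ∈ Ω, F x = y → f x ≤ c := by
  simp only [fiberSup, iSup_le_iff, mem_inter_iff, mem_preimage, mem_singleton_iff, and_imp]

theorem fiberSup_lt {X Y : Type*} {F : X → Y} {Ω : Set X} {f : X → EReal} {y : Y}
    (hfin : (Ω ∩ F ⁻¹' {y}).Finite) {c : EReal} (hc : ⊥ < c) (h : ∀ x ∈ Ω, f x < c) :
    fiberSup F Ω f y < c := by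
  rcases (Ω ∩ F ⁻¹' {y}).eq_empty_or_nonempty with hemp | hne
  · rw [fiberSup, hemp]; simpa using hc
  · obtain ⟨x, hx, hmax⟩ := exists_max_image _ f hfin hne
    exact lt_of_le_of_lt (iSup₂_le hmax) (h x hx.1)

/-- A bound on a neighbourhood of the fibre of `y` holds on all nearby fibres, because `F` is
proper. The intermediate `c'` keeps the inequality strict after taking the supremum. -/
theorem upperSemicontinuousOn_fiberSup {E G : Type*} [NormedAddCommGroup E] [NormedAddCommGroup G]
    {Ω₁ : Set E} {Ω₂ : Set G} {F : E → G} (hmaps : MapsTo F Ω₁ Ω₂)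
    (hproper : IsProperMap (hmaps.restrict F Ω₁ Ω₂)) (hΩ₁ : IsOpen Ω₁) (hΩ₂ : IsOpen Ω₂)
    {f : E → EReal} (hf : UpperSemicontinuousOn f Ω₁) :
    UpperSemicontinuousOn (fiberSup F Ω₁ f) Ω₂ := by
  intro y hy c hc
  obtain ⟨c', hc1, hc2⟩ := exists_between hc
  refine mem_nhdsWithin_of_mem_nhds ?_
  have := eventually_fiber_of_isProperMap hmaps hproper hΩ₂ hy (P := fun x => f x < c')
    (fun x hx hxy => by
      have h1 : f x < c' := lt_of_le_of_lt (by rw [← hxy]; exact le_fiberSup f hx) hc1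
      have h2 := hf x hx c' h1
      rwa [hΩ₁.nhdsWithin_eq hx] at h2)
  filter_upwards [this] with y' hy'
  exact lt_of_le_of_lt (fiberSup_le_iff.2 fun x hx hxy => (hy' x hx hxy).le) hc2

section PushForward

variable {E : Type*} [NormedAddCommGroup E] [InnerProductSpace ℂ E] [FiniteDimensional ℂ E]
  {Ω₁ Ω₂ : Set E} {F : E → E}

/-- Plurisubharmonic functions push forward under finite proper holomorphic maps. -/
theorem IsPlurisubharmonicOn.fiberSup (hmaps : MapsTo F Ω₁ Ω₂)
    (hproper : IsProperMap (hmaps.restrict F Ω₁ Ω₂)) (hΩ₁ : IsOpen Ω₁) (hΩ₂ : IsOpen Ω₂)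
    (hF : DifferentiableOn ℂ F Ω₁)
    (hdense : ∀ U ⊆ Ω₁, IsOpen U → U.Nonempty → ∃ x ∈ U, (fderiv ℂ F x).det ≠ 0)
    (hfin : ∀ y, (Ω₁ ∩ F ⁻¹' {y}).Finite) {f : E → EReal} (hf : IsPlurisubharmonicOn f Ω₁) :
    IsPlurisubharmonicOn (fiberSup F Ω₁ f) Ω₂ := by
  have husc := upperSemicontinuousOn_fiberSup hmaps hproper hΩ₁ hΩ₂ hf.upperSemicontinuousOn
  refine isPlurisubharmonicOn_of_holomorphicSubmean husc
    (fun y _ => fiberSup_lt (hfin y) bot_lt_top hf.lt_top) fun a b hdisc H hH hle => ?_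
  simp only [zero_smul, add_zero]
  refine fiberSup_le_iff.2 fun x₀ hx₀ hFx₀ => ?_
  refine EReal.le_of_forall_lt_iff_le.1 fun c hc => ?_
  rw [EReal.coe_lt_coe_iff] at hc
  set η := c - (H 0).re with hη
  have hη0 : 0 < η := sub_pos.2 hc
  have hHc : ContinuousOn H (Metric.closedBall 0 1) := by
    rw [← closure_ball _ one_ne_zero]; exact hH.continuousOn
  -- The point `x₀` over the centre may be critical, so the disc is translated to be centred at `F
  -- x` with `x` regular near `x₀`. Compactness keeps the translate in `Ω₂` and, in `htube2`, its
  -- boundary bound within `η` of the original.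
  have htube1 : ∀ᶠ y in 𝓝 a, ∀ t ∈ Metric.closedBall (0 : ℂ) 1, y + t • b ∈ Ω₂ := by
    refine (isCompact_closedBall 0 1).eventually_forall_of_forall_eventually fun t ht => ?_
    have h1 : Continuous fun z : E × ℂ => z.1 + z.2 • b := by fun_prop
    exact h1.continuousAt.eventually (hΩ₂.mem_nhds (hdisc t (by simpa using ht)))
  have htube2 : ∀ᶠ y in 𝓝 a, ∀ t ∈ Metric.sphere (0 : ℂ) 1, t ∈ Metric.closedBall (0 : ℂ) 1 →
      _root_.fiberSup F Ω₁ f (y + t • b) ≤ (((H t).re + η : ℝ) : EReal) := by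
    refine (isCompact_sphere 0 1).eventually_forall_of_forall_eventually fun t ht => ?_
    have htb := Metric.sphere_subset_closedBall ht
    have h1 : Continuous fun z : E × ℂ => z.1 + z.2 • b := by fun_prop
    have hmem : a + t • b ∈ Ω₂ := hdisc t (by simpa using htb)
    have h2 : ∀ᶠ y in 𝓝 (a + t • b), _root_.fiberSup F Ω₁ f y <
        (((H t).re + η / 2 : ℝ) : EReal) := by
      have := husc _ hmem _ (lt_of_le_of_lt (hle t ht)
        (EReal.coe_lt_coe_iff.2 (lt_add_of_pos_right _ (half_pos hη0))))
      rwa [hΩ₂.nhdsWithin_eq hmem] at this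
    have h3 : ∀ᶠ s in 𝓝 t, s ∈ Metric.closedBall (0 : ℂ) 1 → (H t).re - η / 2 < (H s).re := by
      rw [← eventually_nhdsWithin_iff]
      exact (Complex.continuous_re.continuousAt.comp_continuousWithinAt
        (hHc t htb)).eventually_const_lt (by simp only [Function.comp]; linarith)
    have h4 : ∀ᶠ z : E × ℂ in 𝓝 (a, t), _root_.fiberSup F Ω₁ f (z.1 + z.2 • b) <
        (((H t).re + η / 2 : ℝ) : EReal) := (h1.continuousAt (x := (a, t))).eventually h2
    filter_upwards [h4, (continuousAt_snd (p := (a, t))).eventually h3] with z hz1 hz2 hz3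
    refine hz1.le.trans (EReal.coe_le_coe_iff.2 ?_)
    have := hz2 hz3
    linarith
  refine hf.le_of_eventually_le_of_det_ne_zero hΩ₁ hF hdense hx₀ ?_
  have hFc : ContinuousAt F x₀ := (hF.differentiableAt (hΩ₁.mem_nhds hx₀)).continuousAt
  rw [ContinuousAt, hFx₀] at hFc
  filter_upwards [hFc.eventually htube1, hFc.eventually htube2, hΩ₁.eventually_mem hx₀]
    with x hx1 hx2 hxΩ hJ
  have hd : ∀ t : ℂ, ‖t‖ ≤ 1 → F x + t • b ∈ Ω₂ := fun t ht => hx1 t (by simpa using ht)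
  have := hf.le_re_of_mem_preimage_disc hΩ₁ hF
    (isCompact_preimage_disc_of_isProperMap hmaps hproper hF.continuousOn hd)
    (H := fun t => H t + (η : ℂ)) (hH.add_const _) (fun x' hx' t ht hFx' => by
      have h1 := hx2 t (by simpa using ht) (by simp [ht])
      rw [← hFx'] at h1
      rw [Complex.add_re, Complex.ofReal_re]
      exact (le_fiberSup f hx').trans h1) hxΩ (t := 0) (by simp) (by simp) hJ
  rw [Complex.add_re, Complex.ofReal_re, hη] at this
  rwa [add_sub_cancel] at this

end PushForward

theorem IsPlurisubharmonicOn.comp_differentiableOn {E G : Type*} [NormedAddCommGroup E]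
    [NormedSpace ℂ E] [NormedAddCommGroup G] [InnerProductSpace ℂ G] [FiniteDimensional ℂ G]
    {Ω₁ : Set E} {Ω₂ : Set G} (hΩ₁ : IsOpen Ω₁) (hΩ₂ : IsOpen Ω₂) {F : E → G}
    (hF : DifferentiableOn ℂ F Ω₁) (hmaps : MapsTo F Ω₁ Ω₂) {f : G → EReal}
    (hf : IsPlurisubharmonicOn f Ω₂) : IsPlurisubharmonicOn (fun z => f (F z)) Ω₁ := by
  refine isPlurisubharmonicOn_of_holomorphicSubmean
    (hf.upperSemicontinuousOn.comp hF.continuousOn hmaps) (fun z hz => hf.lt_top _ (hmaps hz))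
    fun a b hdisc => ?_
  have haff : Differentiable ℂ fun t : ℂ => a + t • b := by fun_prop
  exact hf.holomorphicSubmean_comp hΩ₂ (φ := fun t : ℂ => F (a + t • b))
    (hΩ₁.preimage haff.continuous) (hF.comp haff.differentiableOn fun t ht => ht)
    (fun t ht => hdisc t (by simpa using ht)) (fun t ht => hmaps (hdisc t (by simpa using ht)))

/-- `F` is Lipschitz at `a`, so `log ‖F z - F a‖ ≤ log ‖z - a‖ + log L`. The pole condition says
nothing about the value at the pole, hence the need for `F z ≠ F a`. -/
theorem HasLogPole.comp {E G : Type*} [NormedAddCommGroup E] [NormedSpace ℂ E]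
    [NormedAddCommGroup G] [NormedSpace ℂ G] {F : E → G} {f : G → EReal} {a : E}
    (hf : HasLogPole f 1 (F a)) (hF : DifferentiableAt ℂ F a)
    (hne : ∀ᶠ z in 𝓝[≠] a, F z ≠ F a) : HasLogPole (fun z => f (F z)) 1 a := by
  obtain ⟨C, hC⟩ := hf
  obtain ⟨L, hL0, hL⟩ := hF.hasFDerivAt.isBigO_sub.exists_pos
  refine ⟨Real.log L + C, ?_⟩
  have htend : Tendsto F (𝓝[≠] a) (𝓝[≠] (F a)) :=
    tendsto_nhdsWithin_iff.2 ⟨hF.continuousAt.tendsto.mono_left nhdsWithin_le_nhds, hne⟩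
  filter_upwards [htend.eventually hC, hne, mem_nhdsWithin_of_mem_nhds hL.bound,
    self_mem_nhdsWithin] with z h1 h2 h3 h4
  refine h1.trans (EReal.coe_le_coe_iff.2 ?_)
  have h5 : 0 < ‖F z - F a‖ := norm_pos_iff.2 (sub_ne_zero.2 h2)
  have h6 : 0 < ‖z - a‖ := norm_pos_iff.2 (sub_ne_zero.2 h4)
  have h7 := Real.log_le_log h5 h3
  rw [Real.log_mul hL0.ne' h6.ne'] at h7
  linarith

/-- Finite fibres pass to every open piece, so regular points are dense. -/
theorem exists_det_fderiv_ne_zero_of_finite_fibers {E : Type*} [NormedAddCommGroup E]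
    [NormedSpace ℂ E] [FiniteDimensional ℂ E] {F : E → E} {Ω : Set E}
    (hF : DifferentiableOn ℂ F Ω) (hfin : ∀ y, (Ω ∩ F ⁻¹' {y}).Finite) :
    ∀ U ⊆ Ω, IsOpen U → U.Nonempty → ∃ x ∈ U, (fderiv ℂ F x).det ≠ 0 := by
  intro U hU hUo hne
  obtain ⟨x, hx, hinj⟩ := exists_injective_fderiv_of_finite_fibers _ rfl hUo hne (hF.mono hU)
    fun y => (hfin y).subset (inter_subset_inter_left _ hU)
  refine ⟨x, hx, fun hdet => ?_⟩
  have h1 := LinearMap.bot_lt_ker_of_det_eq_zero (f := (fderiv ℂ F x).toLinearMap) hdet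
  rw [LinearMap.ker_eq_bot.2 hinj] at h1
  exact lt_irrefl _ h1

/-! ### Two-point fibres and the Green function -/

section TwoPointFibers

variable {E : Type*} [NormedAddCommGroup E] [InnerProductSpace ℂ E] [FiniteDimensional ℂ E]
  {Ω : Set E} {F : E → E}

/-- If the fibres of a holomorphic map have at most two points, its local inverse at a point of a
two-point fibre is Lipschitz. -/
theorem exists_norm_sub_le_of_two_point_fiber (hΩ : IsOpen Ω) (hF : DifferentiableOn ℂ F Ω)
    (hfin : ∀ y, (Ω ∩ F ⁻¹' {y}).Finite)
    (hthree : ∀ x ∈ Ω, ∀ y ∈ Ω, ∀ z ∈ Ω, F x = F y → F y = F z → x = y ∨ x = z ∨ y = z)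
    {w₁ w₂ : E} (hw₁ : w₁ ∈ Ω) (hw₂ : w₂ ∈ Ω) (hne : w₁ ≠ w₂) (hw : F w₁ = F w₂) :
    ∃ C > 0, ∀ᶠ x in 𝓝 w₁, ‖x - w₁‖ ≤ C * ‖F x - F w₁‖ := by
  have : ProperSpace E := FiniteDimensional.proper ℂ E
  have hdense := exists_det_fderiv_ne_zero_of_finite_fibers hF hfin
  obtain ⟨ρ₁, hρ₁, hsub₁⟩ := Metric.isOpen_iff.1 hΩ w₁ hw₁
  obtain ⟨ρ₂, hρ₂, hsub₂⟩ := Metric.isOpen_iff.1 hΩ w₂ hw₂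
  have hd : 0 < dist w₁ w₂ := dist_pos.2 hne
  obtain ⟨ρ, hρ, hρ'⟩ := exists_between (lt_min hρ₁ (lt_min hρ₂ (half_pos hd)))
  rw [lt_min_iff, lt_min_iff] at hρ'
  obtain ⟨hρρ₁, hρρ₂, hρd⟩ := hρ'
  have hcl₁ : Metric.closedBall w₁ ρ ⊆ Ω := (Metric.closedBall_subset_ball hρρ₁).trans hsub₁
  have hcl₂ : Metric.closedBall w₂ ρ ⊆ Ω := (Metric.closedBall_subset_ball hρρ₂).trans hsub₂
  have hdisj : ∀ x ∈ Metric.closedBall w₁ ρ, ∀ y ∈ Metric.closedBall w₂ ρ, x ≠ y := by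
    rintro x hx _ hy rfl
    rw [Metric.mem_closedBall] at hx hy
    have := dist_triangle_left w₁ w₂ x
    linarith
  have hgap : ∀ w ∈ Ω, Metric.closedBall w ρ ⊆ Ω → (∀ x ∈ Metric.sphere w ρ, F x ≠ F w) →
      ∃ η > 0, ∀ x ∈ Metric.sphere w ρ, η ≤ ‖F x - F w‖ := by
    intro w _ hcl hFne
    rcases (Metric.sphere w ρ).eq_empty_or_nonempty with hemp | hS
    · exact ⟨1, one_pos, by simp [hemp]⟩
    · have hc : ContinuousOn (fun x => ‖F x - F w‖) (Metric.sphere w ρ) :=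
        ((hF.continuousOn.mono (Metric.sphere_subset_closedBall.trans hcl)).sub
          continuousOn_const).norm
      obtain ⟨x, hx, hmin⟩ := (isCompact_sphere w ρ).exists_isMinOn hS hc
      exact ⟨‖F x - F w‖, norm_pos_iff.2 (sub_ne_zero.2 (hFne x hx)), fun y hy => hmin hy⟩
  have hFne : ∀ x ∈ Ω, F x = F w₁ → x = w₁ ∨ x = w₂ := by
    intro x hx hFx
    rcases hthree x hx w₁ hw₁ w₂ hw₂ hFx hw with h | h | h
    · exact Or.inl h
    · exact Or.inr h
    · exact absurd h hne
  have hself : ∀ w : E, w ∉ Metric.sphere w ρ := by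
    intro w h
    rw [Metric.mem_sphere, dist_self] at h
    exact hρ.ne h
  obtain ⟨η₁, hη₁, hsph₁⟩ := hgap w₁ hw₁ hcl₁ fun x hx hFx => by
    have hxcl := Metric.sphere_subset_closedBall hx
    rcases hFne x (hcl₁ hxcl) hFx with rfl | rfl
    · exact hself _ hx
    · exact hdisj _ hxcl _ (Metric.mem_closedBall_self hρ.le) rfl
  obtain ⟨η₂, hη₂, hsph₂⟩ := hgap w₂ hw₂ hcl₂ fun x hx hFx => by
    have hxcl := Metric.sphere_subset_closedBall hx
    rcases hFne x (hcl₂ hxcl) (hFx.trans hw.symm) with rfl | rfl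
    · exact hdisj _ (Metric.mem_closedBall_self hρ.le) _ hxcl rfl
    · exact hself _ hx
  -- The quarter of `η₂` is the radius within which openness at `w₂` provides preimages.
  obtain ⟨η, hη, hη'⟩ := exists_between (lt_min hη₁ (div_pos hη₂ four_pos))
  rw [lt_min_iff] at hη'
  -- The value `F x` is also taken at a point near `w₂`, outside the ball about `w₁`; two distinct
  -- preimages near `w₁` would make three.
  have hinj : ∀ x ∈ Metric.ball w₁ ρ, ∀ x' ∈ Metric.ball w₁ ρ, ‖F x - F w₁‖ < η → F x = F x' →
      x = x' := by
    intro x hx x' hx' hFx hxx'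
    obtain ⟨x'', hx'', hFx''⟩ := exists_mem_ball_eq_of_isolated hF hdense hρ hη₂ hcl₂ hsph₂
      (y := F x) (by rw [← hw]; linarith)
    have hxc := Metric.ball_subset_closedBall hx
    have hxc' := Metric.ball_subset_closedBall hx'
    have hxc'' := Metric.ball_subset_closedBall hx''
    rcases hthree x (hcl₁ hxc) x' (hcl₁ hxc') x'' (hcl₂ hxc'') hxx' (hxx'.symm.trans hFx''.symm)
      with h | h | h
    · exact h
    · exact absurd h (hdisj _ hxc _ hxc'')
    · exact absurd h (hdisj _ hxc' _ hxc'')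
  refine ⟨4 * ρ / η, by positivity, ?_⟩
  have hFc : ContinuousAt F w₁ := (hF.differentiableAt (hΩ.mem_nhds hw₁)).continuousAt
  have hnear : ∀ᶠ x in 𝓝 w₁, ‖F x - F w₁‖ < η / 4 :=
    (hFc.sub continuousAt_const).norm.eventually_lt_const (by simpa using hη)
  filter_upwards [hnear, Metric.ball_mem_nhds w₁ hρ] with x hx hxb
  exact norm_sub_le_of_injOn hΩ hF hdense hη hcl₁
    (fun z hz => hη'.1.le.trans (hsph₁ z hz)) hinj hxb hx

end TwoPointFibers

/-- The Lipschitz bound for the inverse converts `log ‖x - a‖` into `log ‖F x - F a‖` up to a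
constant, so the pole can be read off in the target. -/
theorem HasLogPole.exists_eventually_le {E G : Type*} [NormedAddCommGroup E]
    [NormedAddCommGroup G] {F : E → G} {f : E → EReal} {a : E} (hf : HasLogPole f 1 a) {C : ℝ}
    (hC0 : 0 < C) (hC : ∀ᶠ x in 𝓝 a, ‖x - a‖ ≤ C * ‖F x - F a‖) :
    ∃ B : ℝ, ∀ᶠ x in 𝓝 a, F x ≠ F a → f x ≤ ((Real.log ‖F x - F a‖ + B : ℝ) : EReal) := by
  obtain ⟨A, hA⟩ := hf
  refine ⟨Real.log C + A, ?_⟩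
  rw [eventually_nhdsWithin_iff] at hA
  filter_upwards [hA, hC] with x hx1 hx2 hx3
  have hxa : x ≠ a := fun h => hx3 (by rw [h])
  refine (hx1 hxa).trans (EReal.coe_le_coe_iff.2 ?_)
  have h5 : 0 < ‖F x - F a‖ := norm_pos_iff.2 (sub_ne_zero.2 hx3)
  have h6 : 0 < ‖x - a‖ := norm_pos_iff.2 (sub_ne_zero.2 hxa)
  have h7 := Real.log_le_log h6 hx2
  rw [Real.log_mul hC0.ne' h5.ne'] at h7
  linarith

/-- The pluricomplex Green function under a proper holomorphic map all of whose fibres have at most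
two points. -/
theorem pluricomplexGreen_eq_of_two_point_fibers {E : Type*} [NormedAddCommGroup E]
    [InnerProductSpace ℂ E] [FiniteDimensional ℂ E] {Ω₁ Ω₂ : Set E} {F : E → E}
    (hΩ₁ : IsOpen Ω₁) (hΩ₂ : IsOpen Ω₂) (hF : DifferentiableOn ℂ F Ω₁) (hmaps : MapsTo F Ω₁ Ω₂)
    (hproper : IsProperMap (hmaps.restrict F Ω₁ Ω₂)) (hfin : ∀ y, (Ω₁ ∩ F ⁻¹' {y}).Finite)
    (hthree : ∀ x ∈ Ω₁, ∀ y ∈ Ω₁, ∀ z ∈ Ω₁, F x = F y → F y = F z → x = y ∨ x = z ∨ y = z)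
    {w₁ w₂ w : E} (hw₁ : w₁ ∈ Ω₁) (hw₂ : w₂ ∈ Ω₁) (hne : w₁ ≠ w₂) (hFw₁ : F w₁ = w)
    (hFw₂ : F w₂ = w) {z : E} (hz : z ∈ Ω₁) :
    pluricomplexGreen Ω₂ {w} (fun _ => 1) (F z) =
      pluricomplexGreen Ω₁ {w₁, w₂} (fun _ => 1) z := by
  have hpull : ∀ a ∈ Ω₁, F a = w → ∀ f : E → EReal, HasLogPole f 1 w →
      HasLogPole (fun z => f (F z)) 1 a := by
    rintro a ha rfl f hf
    refine hf.comp (hF.differentiableAt (hΩ₁.mem_nhds ha)) ?_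
    have h1 : ∀ᶠ x in 𝓝[≠] a, x ∉ Ω₁ ∩ F ⁻¹' {F a} := by
      have h2 : ((Ω₁ ∩ F ⁻¹' {F a}) \ {a}).Finite := (hfin _).sdiff
      have h3 := h2.isClosed.isOpen_compl.mem_nhds (x := a) (by simp)
      filter_upwards [mem_nhdsWithin_of_mem_nhds h3, self_mem_nhdsWithin] with x hx1 hx2 hx3
      exact hx1 ⟨hx3, hx2⟩
    filter_upwards [h1, mem_nhdsWithin_of_mem_nhds (hΩ₁.mem_nhds ha)] with x hx1 hx2 hx3
    exact hx1 ⟨hx2, hx3⟩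
  refine le_antisymm (iSup₂_le fun f hf => ?_) (iSup₂_le fun f hf => ?_)
  · obtain ⟨hpsh, hneg, hpole⟩ := hf
    refine le_iSup₂ (f := fun (g : E → EReal) (_ : g ∈ greenFamily Ω₁ {w₁, w₂} fun _ => 1) => g z)
      (fun z => f (F z)) ⟨hpsh.comp_differentiableOn hΩ₁ hΩ₂ hF hmaps,
        fun x hx => hneg _ (hmaps hx), ?_⟩
    have hp := hpole w rfl
    rintro a (rfl | rfl)
    · exact hpull _ hw₁ hFw₁ f hp
    · exact hpull _ hw₂ hFw₂ f hp
  · obtain ⟨hpsh, hneg, hpole⟩ := hf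
    refine (le_fiberSup (F := F) f hz).trans ?_
    refine le_iSup₂ (f := fun (g : E → EReal) (_ : g ∈ greenFamily Ω₂ {w} fun _ => 1) => g (F z))
      (fiberSup F Ω₁ f) ⟨hpsh.fiberSup hmaps hproper hΩ₁ hΩ₂ hF
        (exists_det_fderiv_ne_zero_of_finite_fibers hF hfin) hfin,
        fun y _ => fiberSup_lt (hfin y) EReal.bot_lt_zero hneg, ?_⟩
    intro w' hw'
    rw [mem_singleton_iff.1 hw']
    obtain ⟨C₁, hC₁0, hC₁⟩ := exists_norm_sub_le_of_two_point_fiber hΩ₁ hF hfin hthree hw₁ hw₂ hne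
      (hFw₁.trans hFw₂.symm)
    obtain ⟨C₂, hC₂0, hC₂⟩ := exists_norm_sub_le_of_two_point_fiber hΩ₁ hF hfin hthree hw₂ hw₁
      hne.symm (hFw₂.trans hFw₁.symm)
    obtain ⟨B₁, hB₁⟩ := (hpole w₁ (Or.inl rfl)).exists_eventually_le hC₁0 hC₁
    obtain ⟨B₂, hB₂⟩ := (hpole w₂ (Or.inr rfl)).exists_eventually_le hC₂0 hC₂
    rw [hFw₁] at hB₁
    rw [hFw₂] at hB₂
    refine ⟨max B₁ B₂, ?_⟩
    rw [eventually_nhdsWithin_iff]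
    have hwΩ : w ∈ Ω₂ := hFw₁ ▸ hmaps hw₁
    -- By properness, all points over a value near `w` lie near `w₁` or `w₂`, where the local pole
    -- bounds hold.
    filter_upwards [eventually_fiber_of_isProperMap hmaps hproper hΩ₂ hwΩ
      (P := fun x => F x ≠ w → f x ≤ ((Real.log ‖F x - w‖ + max B₁ B₂ : ℝ) : EReal))
      (fun x hx hFx => by
        rcases hthree x hx w₁ hw₁ w₂ hw₂ (hFx.trans hFw₁.symm) (hFw₁.trans hFw₂.symm) with
          rfl | rfl | h
        · filter_upwards [hB₁] with x' h1 h2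
          exact (h1 h2).trans (EReal.coe_le_coe_iff.2 (by linarith [le_max_left B₁ B₂]))
        · filter_upwards [hB₂] with x' h1 h2
          exact (h1 h2).trans (EReal.coe_le_coe_iff.2 (by linarith [le_max_right B₁ B₂]))
        · exact absurd h hne)] with y hy hyw
    rw [one_mul]
    refine fiberSup_le_iff.2 fun x hx hFx => ?_
    have := hy x hx hFx (by rw [hFx]; exact hyw)
    rwa [hFx] at this

theorem pluricomplexGreen_eq_of_isTwoToOne {n m : ℕ} {Ω₁ : Set (EuclideanSpace ℂ (Fin n))}
    {Ω₂ : Set (EuclideanSpace ℂ (Fin m))} {F : EuclideanSpace ℂ (Fin n) → EuclideanSpace ℂ (Fin m)}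
    (hΩ₁ : IsDomainSet Ω₁) (hΩ₂ : IsDomainSet Ω₂) (hF : DifferentiableOn ℂ F Ω₁)
    (hmaps : MapsTo F Ω₁ Ω₂) (hproper : IsProperMap (hmaps.restrict F Ω₁ Ω₂))
    (htwo : IsTwoToOne F Ω₁ Ω₂) {w₁ w₂ : EuclideanSpace ℂ (Fin n)} (hw₁ : w₁ ∈ Ω₁)
    (hw₂ : w₂ ∈ Ω₁) (hne : w₁ ≠ w₂) {w : EuclideanSpace ℂ (Fin m)} (hFw₁ : F w₁ = w)
    (hFw₂ : F w₂ = w) {z : EuclideanSpace ℂ (Fin n)} (hz : z ∈ Ω₁) :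
    pluricomplexGreen Ω₂ {w} (fun _ => 1) (F z) =
      pluricomplexGreen Ω₁ {w₁, w₂} (fun _ => 1) z := by
  have hfinΩ : ∀ y ∈ Ω₂, (Ω₁ ∩ F ⁻¹' {y}).Finite := fun y hy =>
    finite_of_ncard_ne_zero (by rcases htwo.1 y hy with h | h <;> omega)
  have hfin : ∀ y, (Ω₁ ∩ F ⁻¹' {y}).Finite := by
    intro y
    by_cases hy : y ∈ Ω₂
    · exact hfinΩ y hy
    · convert Set.finite_empty
      refine eq_empty_of_forall_notMem fun x hx => hy ?_
      have h1 : F x = y := hx.2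
      rw [← h1]
      exact hmaps hx.1
  have hthree : ∀ x ∈ Ω₁, ∀ y ∈ Ω₁, ∀ z ∈ Ω₁, F x = F y → F y = F z →
      x = y ∨ x = z ∨ y = z := by
    intro x hx y hy z hz hxy hyz
    by_contra! h
    have h1 : 2 < (Ω₁ ∩ F ⁻¹' {F x}).ncard :=
      (two_lt_ncard_iff (hfin _)).2 ⟨x, y, z, ⟨hx, rfl⟩, ⟨hy, hxy.symm⟩,
        ⟨hz, (hxy.trans hyz).symm⟩, h.1, h.2.1, h.2.2⟩
    rcases htwo.1 (F x) (hmaps hx) with h2 | h2 <;> omega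
  have himg : Ω₂ ⊆ F '' Ω₁ := by
    intro y hy
    have h1 : (Ω₁ ∩ F ⁻¹' {y}).ncard ≠ 0 := by rcases htwo.1 y hy with h | h <;> omega
    obtain ⟨x, hx, hxy⟩ := nonempty_of_ncard_ne_zero h1
    exact ⟨x, hx, hxy⟩
  -- The fibres are nonempty, so the image contains the open set `Ω₂`.
  have hnm : n = m := by
    have := finrank_eq_of_finite_fibers hΩ₁.1 hF hfin
      (hΩ₂.2.nonempty.mono (interior_maximal himg hΩ₂.1))
    simpa using this
  subst hnm
  exact pluricomplexGreen_eq_of_two_point_fibers hΩ₁.1 hΩ₂.1 hF hmaps hproper hfin hthree hw₁ hw₂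
    hne hFw₁ hFw₂ hz

/-! ### The symmetrized bidisk -/

theorem differentiable_symmetrization : Differentiable ℂ symmetrization := by
  rw [differentiable_euclidean]
  intro i
  have h : ∀ j : Fin 2, Differentiable ℂ fun z : EuclideanSpace ℂ (Fin 2) => z j := fun j =>
    (EuclideanSpace.proj (𝕜 := ℂ) j).differentiable
  fin_cases i
  · exact (h 0).add (h 1)
  · exact (h 0).mul (h 1)

theorem symmetrization_eq_iff {z z' : EuclideanSpace ℂ (Fin 2)} :
    symmetrization z' = symmetrization z ↔ z' = z ∨ z' = !₂[z 1, z 0] := by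
  constructor
  · intro h
    have h0 : z' 0 + z' 1 = z 0 + z 1 := congrArg (fun v : EuclideanSpace ℂ (Fin 2) => v 0) h
    have h1 : z' 0 * z' 1 = z 0 * z 1 := congrArg (fun v : EuclideanSpace ℂ (Fin 2) => v 1) h
    -- `z' 0` is a root of the monic quadratic with roots `z 0` and `z 1`.
    have h2 : (z' 0 - z 0) * (z' 0 - z 1) = 0 := by linear_combination z' 0 * h0 - h1
    rcases mul_eq_zero.1 h2 with h3 | h3
    · left
      ext i
      fin_cases i
      · exact sub_eq_zero.1 h3
      · change z' 1 = z 1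
        linear_combination h0 - h3
    · right
      ext i
      fin_cases i
      · exact sub_eq_zero.1 h3
      · change z' 1 = z 0
        linear_combination h0 - h3
  · rintro (rfl | rfl)
    · rfl
    · ext i
      fin_cases i
      · exact add_comm _ _
      · exact mul_comm _ _

theorem surjective_symmetrization : Function.Surjective symmetrization := by
  intro y
  obtain ⟨d, hd⟩ := IsAlgClosed.exists_pow_nat_eq (y 0 ^ 2 - 4 * y 1) (n := 2) two_pos
  refine ⟨!₂[(y 0 + d) / 2, (y 0 - d) / 2], ?_⟩
  ext i
  fin_cases i
  · change (y 0 + d) / 2 + (y 0 - d) / 2 = y 0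
    ring
  · change (y 0 + d) / 2 * ((y 0 - d) / 2) = y 1
    linear_combination -hd / 4

theorem isProperMap_symmetrization : IsProperMap symmetrization := by
  rw [isProperMap_iff_isCompact_preimage]
  refine ⟨differentiable_symmetrization.continuous, fun K hK => ?_⟩
  obtain ⟨M, hM⟩ := hK.isBounded.exists_norm_le
  -- The roots of a monic quadratic are bounded in terms of its coefficients: `‖a‖² ≤ M ‖a‖ + M`
  -- forces `‖a‖ ≤ M + 1`. It is used for both orders of the coordinates.
  have hroot : ∀ z ∈ symmetrization ⁻¹' K, ∀ a b : ℂ, a + b = symmetrization z 0 →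
      a * b = symmetrization z 1 → ‖a‖ ≤ M + 1 := by
    intro z hz a b h0 h1
    have hs := (PiLp.norm_apply_le (symmetrization z) 0).trans (hM _ hz)
    have hp := (PiLp.norm_apply_le (symmetrization z) 1).trans (hM _ hz)
    have h2 : a ^ 2 = symmetrization z 0 * a - symmetrization z 1 := by
      rw [← h0, ← h1]; ring
    have h3 : ‖a‖ ^ 2 ≤ M * ‖a‖ + M := by
      rw [← norm_pow, h2]
      refine (norm_sub_le _ _).trans ?_
      rw [norm_mul]
      gcongr
    by_contra! h
    nlinarith [norm_nonneg a]
  refine Metric.isCompact_of_isClosed_isBounded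
    (hK.isClosed.preimage differentiable_symmetrization.continuous) ?_
  refine isBounded_iff_forall_norm_le.2 ⟨√(2 * (M + 1) ^ 2), fun z hz => ?_⟩
  have h0 := hroot z hz (z 0) (z 1) rfl rfl
  have h1 := hroot z hz (z 1) (z 0) (add_comm _ _) (mul_comm _ _)
  rw [EuclideanSpace.norm_eq, Fin.sum_univ_two]
  refine Real.sqrt_le_sqrt ?_
  have e0 : ‖z 0‖ ^ 2 ≤ (M + 1) ^ 2 := by gcongr
  have e1 : ‖z 1‖ ^ 2 ≤ (M + 1) ^ 2 := by gcongr
  linarith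

/-- The bidisk is invariant under swapping coordinates, hence saturated; this is what lets global
properness restrict to the bidisk. -/
theorem bidisk_eq_preimage : bidisk = symmetrization ⁻¹' symmetrizedBidisk := by
  refine Subset.antisymm (fun z hz => ⟨z, hz, rfl⟩) ?_
  rintro z ⟨z', hz', h⟩
  rcases symmetrization_eq_iff.1 h.symm with rfl | rfl
  · exact hz'
  · exact ⟨hz'.2, hz'.1⟩

theorem isDomainSet_bidisk : IsDomainSet bidisk := by
  have h : ∀ j : Fin 2, Continuous fun z : EuclideanSpace ℂ (Fin 2) => z j := fun j =>
    (EuclideanSpace.proj (𝕜 := ℂ) j).continuous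
  refine ⟨(isOpen_lt (h 0).norm continuous_const).inter (isOpen_lt (h 1).norm continuous_const),
    ⟨0, by simp [bidisk]⟩, Convex.isPreconnected (fun z hz w hw a b ha hb hab => ?_)⟩
  have key : ∀ {x y : ℂ}, ‖x‖ < 1 → ‖y‖ < 1 → ‖a • x + b • y‖ < 1 := by
    intro x y hx hy
    have := convex_ball (0 : ℂ) 1 (mem_ball_zero_iff.2 hx) (mem_ball_zero_iff.2 hy) ha hb hab
    exact mem_ball_zero_iff.1 this
  exact ⟨key hz.1 hw.1, key hz.2 hw.2⟩

theorem isDomainSet_symmetrizedBidisk : IsDomainSet symmetrizedBidisk := by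
  refine ⟨?_, isDomainSet_bidisk.2.image _ differentiable_symmetrization.continuous.continuousOn⟩
  -- Openness follows since the complement is the image of a closed set under a proper, hence
  -- closed, map.
  have h : symmetrizedBidiskᶜ = symmetrization '' bidiskᶜ := by
    rw [bidisk_eq_preimage, ← preimage_compl, image_preimage_eq _ surjective_symmetrization]
  rw [← isClosed_compl_iff, h]
  exact isProperMap_symmetrization.isClosedMap _ isDomainSet_bidisk.1.isClosed_compl

theorem mapsTo_symmetrization : MapsTo symmetrization bidisk symmetrizedBidisk :=
  mapsTo_image _ _

theorem isProperMap_symmetrization_restrict :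
    IsProperMap (mapsTo_symmetrization.restrict symmetrization bidisk symmetrizedBidisk) := by
  have h1 := isProperMap_symmetrization.restrictPreimage symmetrizedBidisk
  have h2 : IsProperMap (Homeomorph.setCongr bidisk_eq_preimage) :=
    (Homeomorph.setCongr bidisk_eq_preimage).isProperMap
  exact h1.comp h2

theorem bidisk_inter_fiber {z : EuclideanSpace ℂ (Fin 2)} (hz : z ∈ bidisk) :
    bidisk ∩ symmetrization ⁻¹' {symmetrization z} = {z, !₂[z 1, z 0]} := by
  ext z'
  simp only [mem_inter_iff, mem_preimage, mem_singleton_iff, mem_insert_iff,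
    symmetrization_eq_iff, and_iff_right_iff_imp]
  rintro (rfl | rfl)
  · exact hz
  · exact ⟨hz.2, hz.1⟩

theorem ncard_bidisk_inter_fiber_of_ne {z : EuclideanSpace ℂ (Fin 2)} (hz : z ∈ bidisk)
    (hne : z 0 ≠ z 1) : (bidisk ∩ symmetrization ⁻¹' {symmetrization z}).ncard = 2 := by
  rw [bidisk_inter_fiber hz]
  refine ncard_pair fun h => hne ?_
  exact congrArg (fun v : EuclideanSpace ℂ (Fin 2) => v 0) h

theorem isTwoToOne_symmetrization : IsTwoToOne symmetrization bidisk symmetrizedBidisk := by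
  constructor
  · rintro _ ⟨z, hz, rfl⟩
    by_cases h : z 0 = z 1
    · left
      have : !₂[z 1, z 0] = z := by
        ext i
        fin_cases i
        · exact h.symm
        · exact h
      rw [bidisk_inter_fiber hz, this, pair_eq_singleton, ncard_singleton]
    · exact Or.inr (ncard_bidisk_inter_fiber_of_ne hz h)
  -- Two-point fibres come from off-diagonal points, and moving the first coordinate leaves the
  -- diagonal.
  · have hcl : bidisk ⊆ closure {z ∈ bidisk | z 0 ≠ z 1} := by
      intro z hz
      let γ : ℂ → EuclideanSpace ℂ (Fin 2) := fun t => z + t • EuclideanSpace.single 0 1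
      have hγ : Continuous γ := by fun_prop
      have hγ0 : γ 0 = z := by simp [γ]
      have h1 : ∀ᶠ t in 𝓝[≠] (0 : ℂ), γ t ∈ bidisk :=
        (hγ.continuousAt.mono_left nhdsWithin_le_nhds).eventually
          (isDomainSet_bidisk.1.mem_nhds (by rwa [hγ0]))
      have h2 : ∀ᶠ t in 𝓝[≠] (0 : ℂ), γ t 0 ≠ γ t 1 := by
        have e0 : ∀ t, γ t 0 = z 0 + t := by intro t; simp [γ]
        have e1 : ∀ t, γ t 1 = z 1 := by intro t; simp [γ]
        simp only [e0, e1]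
        by_cases h : z 0 = z 1
        · filter_upwards [self_mem_nhdsWithin] with t ht
          rw [h]
          simpa using ht
        · refine nhdsWithin_le_nhds ?_
          have : ContinuousAt (fun t : ℂ => z 0 + t) 0 := by fun_prop
          exact this.eventually_ne (by simpa using h)
      refine mem_closure_of_tendsto (f := γ) (b := 𝓝[≠] (0 : ℂ)) ?_ (h1.and h2)
      have := hγ.tendsto 0
      rw [hγ0] at this
      exact this.mono_left nhdsWithin_le_nhds
    rintro _ ⟨z, hz, rfl⟩
    refine closure_mono ?_ (image_closure_subset_closure_image
      differentiable_symmetrization.continuous ⟨z, hcl hz, rfl⟩)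
    rintro _ ⟨z, ⟨hz, hne⟩, rfl⟩
    exact ⟨⟨z, hz, rfl⟩, ncard_bidisk_inter_fiber_of_ne hz hne⟩

theorem mainTheorem6 :
    (∀ (n m : ℕ) (Ω₁ : Set (EuclideanSpace ℂ (Fin n))) (Ω₂ : Set (EuclideanSpace ℂ (Fin m)))
      (F : EuclideanSpace ℂ (Fin n) → EuclideanSpace ℂ (Fin m)),
      IsDomainSet Ω₁ → IsDomainSet Ω₂ → DifferentiableOn ℂ F Ω₁ →
      ∀ hF : Set.MapsTo F Ω₁ Ω₂, IsProperMap (hF.restrict F Ω₁ Ω₂) → IsTwoToOne F Ω₁ Ω₂ →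
      ∀ w₁ ∈ Ω₁, ∀ w₂ ∈ Ω₁, w₁ ≠ w₂ → ∀ w : EuclideanSpace ℂ (Fin m), F w₁ = w → F w₂ = w →
      ∀ z ∈ Ω₁,
        pluricomplexGreen Ω₂ {w} (fun _ => 1) (F z) =
          pluricomplexGreen Ω₁ {w₁, w₂} (fun _ => 1) z) ∧
    (∀ p : ℂ, p ≠ 0 → ‖p‖ < 1 → ∀ z ∈ bidisk,
      pluricomplexGreen symmetrizedBidisk {!₂[p, 0]} (fun _ => 1) (symmetrization z) =
        pluricomplexGreen bidisk {!₂[p, 0], !₂[0, p]} (fun _ => 1) z) := by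
  refine ⟨fun n m Ω₁ Ω₂ F hΩ₁ hΩ₂ hF hmaps hproper htwo w₁ hw₁ w₂ hw₂ hne w hFw₁ hFw₂ z hz =>
    pluricomplexGreen_eq_of_isTwoToOne hΩ₁ hΩ₂ hF hmaps hproper htwo hw₁ hw₂ hne hFw₁ hFw₂ hz,
    fun p hp0 hp1 z hz => ?_⟩
  refine pluricomplexGreen_eq_of_isTwoToOne isDomainSet_bidisk isDomainSet_symmetrizedBidisk
    differentiable_symmetrization.differentiableOn mapsTo_symmetrization
    isProperMap_symmetrization_restrict isTwoToOne_symmetrization ?_ ?_ ?_ ?_ ?_ hz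
  · exact ⟨hp1, by simp⟩
  · exact ⟨by simp, hp1⟩
  · intro h
    exact hp0 (congrArg (fun v : EuclideanSpace ℂ (Fin 2) => v 0) h)
  · ext i
    fin_cases i <;> simp [symmetrization]
  · ext i
    fin_cases i <;> simp [symmetrization]
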